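/- Let $\mathbb B=\{0,1\}$ be the Boolean semifield ($1+1=1$), let $\mathbb Z_{\min}^+=(\mathbb N\cup\{\infty\},\min,+)$, whose element $n\in\mathbb N$ is written multiplicatively $q^n$ (so $\infty$ is the zero element and $q^0$ the unit), and let $\mathbb R_+^{\max}=([0,\infty),\max,\cdot)$. Semirings are commutative. A semiring $R$ is multiplicatively cancellative if $ab=ac$ and $a\neq0$ imply $b=c$. A reduced correspondence is a triple $(R,\ell,r)$ where $R$ is a multiplicatively cancellative semiring and $\ell,r:\mathbb Z_{\min}^+\to R$ are semiring morphisms with $\ell^{-1}(\{0\})=\{0\}=r^{-1}(\{0\})$, such that $R$ is generated by $\ell(\mathbb Z_{\min}^+)\,r(\mathbb Z_{\min}^+)$. Two reduced correspondences are considered equal if there is a semiring isomorphism between them that intertwines the left morphisms and the right morphisms. The composition $(R,\ell,r)\circ(R',\ell',r')$ is obtained from the semiring $S=R\otimes_{\mathbb Z_{\min}^+}R'$, where $\mathbb Z_{\min}^+$ acts on $R$ through $r$ and on $R'$ through $\ell'$: one passes to the multiplicatively cancellative reduction $S/\!\sim$, where $a\sim b$ if and only if $ca=cb$ for some $c\neq0$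 in $S$, and takes the sub-semiring of $S/\!\sim$ generated by the images of $\ell\otimes\mathrm{Id}$ and $\mathrm{Id}\otimes r'$, with these two morphisms as left and right morphisms. Fix $q\in(0,1)$. For $\lambda>0$ let $\mathcal F(\lambda):\mathbb Z_{\min}^+\otimes_{\mathbb B}\mathbb Z_{\min}^+\to\mathbb R_+^{\max}$ be the semiring morphism $\sum q^{n_i}\otimes q^{m_i}\mapsto q^{\inf_i(\lambda n_i+m_i)}$, and let $\mathcal R(\lambda)$ be its range. The Frobenius correspondence is the reduced correspondence $\Psi(\lambda)=(\mathcal R(\lambda),\ell(\lambda),r(\lambda))$ with $\ell(\lambda)(x)=\mathcal F(\lambda)(x\otimes1)$ and $r(\lambda)(x)=\mathcal F(\lambda)(1\otimes x)$. Let $\mathcal R_\epsilon$ be the sub-semiring, generated by the germs of $\epsilon\mapsto q$ and $\epsilon\mapsto q^{1+\epsilon}$, of the semiring of germs at $\epsilon=0$ of continuous functions from a neighborhood of $0\in\mathbb R$ to $\mathbb R_+^{\max}$, with pointwise operations. The tangential deformation of the identity correspondence is $\mathrm{Id}_\epsilon=(\mathcal R_\epsilon,\ell_\epsilon,r_\epsilon)$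 with $\ell_\epsilon(q^n)=q^{(1+\epsilon)n}$ and $r_\epsilon(q^n)=q^n$ for all $n\in\mathbb N$. Theorem. Let $\lambda,\lambda'>0$ be real numbers. (i) If $\lambda\lambda'\notin\mathbb Q$, then $\Psi(\lambda)\circ\Psi(\lambda')=\Psi(\lambda\lambda')$. (ii) If $\lambda\in\mathbb Q$ and $\lambda'\in\mathbb Q$, then $\Psi(\lambda)\circ\Psi(\lambda')=\Psi(\lambda\lambda')$. (iii) If $\lambda$ and $\lambda'$ are irrational and $\lambda\lambda'\in\mathbb Q$, then $\Psi(\lambda)\circ\Psi(\lambda')=\mathrm{Id}_\epsilon\circ\Psi(\lambda\lambda')$. -/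

import Mathlib

open scoped NNReal TensorProduct Topology

namespace ArithmeticSite

universe u

/-! ### Semirings of characteristic one -/

/-- The semiring `ℤ_min^+ = (ℕ ∪ {∞}, min, +)`. The element written multiplicatively `q^n` is
`Tropical.trop n`; the zero element is `Tropical.trop ⊤`, the unit is `Tropical.trop 0 = q^0`. -/
abbrev ZMinPlus : Type := Tropical ℕ∞

/-- The Boolean semifield `𝔹 = {0, 1}` with `1 + 1 = 1`. -/
def BoolSemifield : Type := Bool

namespace BoolSemifield

instance : DecidableEq BoolSemifield := inferInstanceAs (DecidableEq Bool)

instance : Fintype BoolSemifield := inferInstanceAs (Fintype Bool)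

instance : CommSemiring BoolSemifield where
  add a b := Bool.or a b
  zero := false
  mul a b := Bool.and a b
  one := true
  add_assoc := by decide
  zero_add := by decide
  add_zero := by decide
  add_comm := by decide
  mul_assoc := by decide
  mul_comm := by decide
  one_mul := by decide
  mul_one := by decide
  zero_mul := by decide
  mul_zero := by decide
  left_distrib := by decide
  right_distrib := by decide
  nsmul n a := if n = 0 then false else a
  nsmul_zero _ := rfl
  nsmul_succ n a := by
    have h : ∀ a : Bool, Bool.or a a = a := by decide
    rcases n with _ | n
    · exact (Bool.false_or a).symm
    · exact (h a).symm

/-- The structure morphism `𝔹 → R` of a semiring `R` of characteristic one. -/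
def toSemiring (R : Type u) [CommSemiring R] (h : (1 : R) + 1 = 1) : BoolSemifield →+* R where
  toFun a := if a = 0 then 0 else 1
  map_one' := if_neg (by decide)
  map_zero' := if_pos rfl
  map_add' := by
    have key : ∀ a b : BoolSemifield, (a = 0 ∧ b = 0 ∧ a + b = 0) ∨ (a = 0 ∧ b ≠ 0 ∧ a + b ≠ 0) ∨
      (a ≠ 0 ∧ b = 0 ∧ a + b ≠ 0) ∨ (a ≠ 0 ∧ b ≠ 0 ∧ a + b ≠ 0) := by decide
    intro a b
    rcases key a b with ⟨h1, h2, h3⟩ | ⟨h1, h2, h3⟩ | ⟨h1, h2, h3⟩ | ⟨h1, h2, h3⟩ <;>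
      simp only [if_pos, if_neg, h1, h2, h3, not_false_eq_true, zero_add, add_zero, h]
  map_mul' := by
    have key : ∀ a b : BoolSemifield, a * b = 0 ↔ a = 0 ∨ b = 0 := by decide
    intro a b
    by_cases ha : a = 0 <;> by_cases hb : b = 0 <;> simp [key, ha, hb]

/-- The support character `R → 𝔹`, sending `0` to `0` and everything else to `1`. -/
noncomputable def support (R : Type u) [CommSemiring R] [NoZeroDivisors R] [Nontrivial R]
    (h : (1 : R) + 1 = 1) : R →+* BoolSemifield := by
  classical
  have hid : ∀ a : R, a + a = a := fun a => by
    have := congrArg (a * ·) h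
    simpa [mul_add] using this
  have hz : ∀ a b : R, a + b = 0 → a = 0 := fun a b hab => by
    calc a = a + (a + b) := by rw [hab, add_zero]
      _ = a + b := by rw [← add_assoc, hid]
      _ = 0 := hab
  exact
    { toFun := fun a => if a = 0 then 0 else 1
      map_one' := if_neg one_ne_zero
      map_zero' := if_pos rfl
      map_mul' := fun a b => by
        by_cases ha : a = 0 <;> by_cases hb : b = 0 <;> simp [ha, hb]
      map_add' := fun a b => by
        have h11 : (1 : BoolSemifield) + 1 = 1 := by decide
        by_cases ha : a = 0
        · by_cases hb : b = 0 <;> simp [ha, hb]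
        · have hab : a + b ≠ 0 := fun hab => ha (hz a b hab)
          by_cases hb : b = 0
          · simp [ha, hb]
          · simp [ha, hb, hab, h11] }

theorem support_eq_zero {R : Type u} [CommSemiring R] [NoZeroDivisors R] [Nontrivial R]
    (h : (1 : R) + 1 = 1) (a : R) : support R h a = 0 ↔ a = 0 := by
  classical
  change (if a = 0 then (0 : BoolSemifield) else 1) = 0 ↔ a = 0
  have h10 : (1 : BoolSemifield) ≠ 0 := by decide
  by_cases ha : a = 0 <;> simp [ha, h10]

end BoolSemifield

theorem ZMinPlus.one_add_one : (1 : ZMinPlus) + 1 = 1 := Tropical.add_self 1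

noncomputable instance : Algebra BoolSemifield ZMinPlus :=
  (BoolSemifield.toSemiring ZMinPlus ZMinPlus.one_add_one).toAlgebra

/-- The semifield `ℝ_+^max`: the set `[0, ∞)` with addition `max` and the ordinary product. -/
@[ext]
structure RMax : Type where
  val : ℝ≥0

namespace RMax

noncomputable instance : Zero RMax := ⟨⟨0⟩⟩
noncomputable instance : One RMax := ⟨⟨1⟩⟩
noncomputable instance : Add RMax := ⟨fun a b => ⟨max a.val b.val⟩⟩
noncomputable instance : Mul RMax := ⟨fun a b => ⟨a.val * b.val⟩⟩

@[simp] theorem val_zero : (0 : RMax).val = 0 := rfl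
@[simp] theorem val_one : (1 : RMax).val = 1 := rfl
@[simp] theorem val_add (a b : RMax) : (a + b).val = max a.val b.val := rfl
@[simp] theorem val_mul (a b : RMax) : (a * b).val = a.val * b.val := rfl

noncomputable instance : CommSemiring RMax where
  add_assoc a b c := by ext; simp [max_assoc]
  zero_add a := by ext; simp
  add_zero a := by ext; simp
  add_comm a b := by ext; simp [max_comm]
  mul_assoc a b c := by ext; simp [mul_assoc]
  mul_comm a b := by ext; simp [mul_comm]
  one_mul a := by ext; simp
  mul_one a := by ext; simp
  zero_mul a := by ext; simp
  mul_zero a := by ext; simp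
  left_distrib a b c := by ext; simp [mul_max]
  right_distrib a b c := by ext; simp [max_mul]
  nsmul := nsmulRec

theorem one_add_one : (1 : RMax) + 1 = 1 := by ext; simp

theorem mul_left_cancel_of_ne {a b c : RMax} (ha : a ≠ 0) (h : a * b = a * c) : b = c := by
  have ha' : a.val ≠ 0 := fun h0 => ha (RMax.ext h0)
  have h' : a.val * b.val = a.val * c.val := congrArg RMax.val h
  exact RMax.ext (mul_left_cancel₀ ha' h')

noncomputable instance : Algebra BoolSemifield RMax :=
  (BoolSemifield.toSemiring RMax one_add_one).toAlgebra

/-- The usual topology of `[0, ∞)`. -/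
instance : TopologicalSpace RMax := TopologicalSpace.induced RMax.val inferInstance

theorem continuous_val : Continuous RMax.val := continuous_induced_dom

instance : ContinuousAdd RMax :=
  ⟨continuous_induced_rng.2
    ((continuous_val.comp continuous_fst).max (continuous_val.comp continuous_snd))⟩

instance : ContinuousMul RMax :=
  ⟨continuous_induced_rng.2
    ((continuous_val.comp continuous_fst).mul (continuous_val.comp continuous_snd))⟩

/-- The element `q^s` of `ℝ_+^max`, for a real exponent `s`. -/
noncomputable def qpow (q : ℝ≥0) (s : ℝ) : RMax := ⟨q ^ s⟩

theorem qpow_ne_zero {q : ℝ≥0} (hq : 0 < q) (s : ℝ) : qpow q s ≠ 0 := fun h =>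
  (NNReal.rpow_pos hq).ne' (congrArg RMax.val h)

theorem qpow_add_one {q : ℝ≥0} (hq1 : q < 1) {s : ℝ} (hs : 0 ≤ s) : qpow q s + 1 = 1 := by
  ext
  simp [qpow, NNReal.rpow_le_one hq1.le hs]

end RMax

/-- The semiring morphism `ℤ_min^+ → R`, `q^n ↦ x^n`, `∞ ↦ 0`, for `x` with `x + 1 = 1` in a
semiring `R` of characteristic one. -/
noncomputable def powHom {R : Type u} [CommSemiring R] (h : (1 : R) + 1 = 1) (x : R)
    (hx : x + 1 = 1) : ZMinPlus →+* R where
  toFun a := if Tropical.untrop a = ⊤ then 0 else x ^ (Tropical.untrop a).toNat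
  map_one' := by simp
  map_zero' := by simp
  map_mul' a b := by
    rw [Tropical.untrop_mul]
    by_cases ha : Tropical.untrop a = ⊤
    · simp [ha]
    by_cases hb : Tropical.untrop b = ⊤
    · simp [hb]
    · simp [ha, hb, ENat.toNat_add ha hb, pow_add]
  map_add' a b := by
    have hk : ∀ k : ℕ, x ^ k + 1 = 1 := by
      intro k
      induction k with
      | zero => simpa using h
      | succ k ih =>
        calc x ^ (k + 1) + 1 = x ^ k * x + (x ^ k + 1) := by rw [ih, pow_succ]
          _ = x ^ k * (x + 1) + 1 := by ring
          _ = 1 := by rw [hx, mul_one, ih]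
    have hmn : ∀ m n : ℕ, m ≤ n → x ^ m + x ^ n = x ^ m := by
      intro m n hle
      obtain ⟨k, rfl⟩ := Nat.exists_eq_add_of_le hle
      calc x ^ m + x ^ (m + k) = x ^ m * (x ^ k + 1) := by ring
        _ = x ^ m := by rw [hk, mul_one]
    rw [Tropical.untrop_add]
    by_cases ha : Tropical.untrop a = ⊤
    · simp [ha]
    by_cases hb : Tropical.untrop b = ⊤
    · simp [hb]
    obtain ⟨m, hm⟩ := ENat.ne_top_iff_exists.1 ha
    obtain ⟨n, hn⟩ := ENat.ne_top_iff_exists.1 hb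
    rw [← hm, ← hn]
    rcases le_total m n with hle | hle
    · rw [min_eq_left (by exact_mod_cast hle)]
      simp [hmn m n hle]
    · rw [min_eq_right (by exact_mod_cast hle)]
      simp [add_comm (x ^ m), hmn n m hle]

theorem powHom_eq_zero {R : Type u} [CommSemiring R] (h : (1 : R) + 1 = 1) (x : R)
    (hx : x + 1 = 1) (hx0 : ∀ n : ℕ, x ^ n ≠ 0) (a : ZMinPlus) (ha : powHom h x hx a = 0) :
    a = 0 := by
  change (if Tropical.untrop a = ⊤ then 0 else x ^ (Tropical.untrop a).toNat) = 0 at ha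
  by_contra hne
  have : Tropical.untrop a ≠ ⊤ := fun h' => hne (Tropical.untrop_injective h')
  rw [if_neg this] at ha
  exact hx0 _ ha

theorem powHom_trop_one {R : Type u} [CommSemiring R] (h : (1 : R) + 1 = 1) (x : R)
    (hx : x + 1 = 1) : powHom h x hx (Tropical.trop 1) = x := by
  change (if (1 : ℕ∞) = ⊤ then 0 else x ^ (1 : ℕ∞).toNat) = x
  simp

theorem powHom_mem {R : Type u} [CommSemiring R] (h : (1 : R) + 1 = 1) (x : R)
    (hx : x + 1 = 1) (T : Subsemiring R) (hT : x ∈ T) (a : ZMinPlus) : powHom h x hx a ∈ T := by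
  change (if Tropical.untrop a = ⊤ then 0 else x ^ (Tropical.untrop a).toNat) ∈ T
  split_ifs
  · exact T.zero_mem
  · exact T.pow_mem hT _

/-! ### Reduced correspondences -/

/-- A reduced correspondence `(R, ℓ, r)` on the arithmetic site: `R` is a multiplicatively
cancellative semiring, `ℓ, r : ℤ_min^+ → R` are semiring morphisms with `ℓ⁻¹(0) = {0}`,
`r⁻¹(0) = {0}`, and `R` is generated by the products `ℓ(x) r(y)`. -/
structure ReducedCorrespondence : Type (u + 1) where
  carrier : Type u
  [commSemiring : CommSemiring carrier]
  [isCancelMulZero : IsCancelMulZero carrier]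
  left : ZMinPlus →+* carrier
  right : ZMinPlus →+* carrier
  left_preimage_zero : left ⁻¹' {0} = {0}
  right_preimage_zero : right ⁻¹' {0} = {0}
  generated : Subsemiring.closure {z : carrier | ∃ x y, z = left x * right y} = ⊤

attribute [instance] ReducedCorrespondence.commSemiring ReducedCorrespondence.isCancelMulZero

/-- Equality of reduced correspondences: an isomorphism of semirings which intertwines the left
morphisms and the right morphisms. -/
def ReducedCorrespondence.Equal (C D : ReducedCorrespondence.{u}) : Prop :=
  ∃ e : C.carrier ≃+* D.carrier,
    (∀ x, e (C.left x) = D.left x) ∧ (∀ x, e (C.right x) = D.right x)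

/-! ### The multiplicatively cancellative reduction -/

section CancelReduction

variable (S : Type u) [CommSemiring S] [NoZeroDivisors S] [Nontrivial S]

/-- The congruence `a ∼ b ↔ ∃ c ≠ 0, c a = c b`. Its quotient is the image of `S` in its semiring
of quotients. -/
def cancelCon : RingCon S where
  r a b := ∃ c : S, c ≠ 0 ∧ c * a = c * b
  iseqv :=
    { refl := fun _ => ⟨1, one_ne_zero, rfl⟩
      symm := fun ⟨c, hc, h⟩ => ⟨c, hc, h.symm⟩
      trans := fun {x y z} ⟨c, hc, h⟩ ⟨d, hd, h'⟩ => ⟨c * d, mul_ne_zero hc hd, by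
        calc c * d * x = d * (c * x) := by ring
          _ = c * (d * y) := by rw [h]; ring
          _ = c * d * z := by rw [h']; ring⟩ }
  add' := fun {w x y z} ⟨c, hc, h⟩ ⟨d, hd, h'⟩ => ⟨c * d, mul_ne_zero hc hd, by
    calc c * d * (w + y) = d * (c * w) + c * (d * y) := by ring
      _ = c * d * (x + z) := by rw [h, h']; ring⟩
  mul' := fun {w x y z} ⟨c, hc, h⟩ ⟨d, hd, h'⟩ => ⟨c * d, mul_ne_zero hc hd, by
    calc c * d * (w * y) = (c * w) * (d * y) := by ring
      _ = c * d * (x * z) := by rw [h, h']; ring⟩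

/-- The multiplicatively cancellative semiring associated to `S`. -/
abbrev CancelReduction : Type u := (cancelCon S).Quotient

variable {S}

theorem cancelCon_mk_eq {a b : S} :
    (cancelCon S).mk' a = (cancelCon S).mk' b ↔ ∃ c : S, c ≠ 0 ∧ c * a = c * b :=
  (cancelCon S).eq

theorem cancelCon_mk_eq_zero {a : S} : (cancelCon S).mk' a = 0 ↔ a = 0 := by
  constructor
  · intro h
    rw [← map_zero (cancelCon S).mk', cancelCon_mk_eq] at h
    obtain ⟨c, hc, h⟩ := h
    rw [mul_zero] at h
    exact (mul_eq_zero.1 h).resolve_left hc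
  · rintro rfl
    exact map_zero _

instance : IsCancelMulZero (CancelReduction S) := by
  have key : ∀ a b c : CancelReduction S, a ≠ 0 → a * b = a * c → b = c := by
    intro a b c ha h
    obtain ⟨a, rfl⟩ := (cancelCon S).mk'_surjective a
    obtain ⟨b, rfl⟩ := (cancelCon S).mk'_surjective b
    obtain ⟨c, rfl⟩ := (cancelCon S).mk'_surjective c
    rw [← map_mul, ← map_mul, cancelCon_mk_eq] at h
    obtain ⟨d, hd, h⟩ := h
    refine cancelCon_mk_eq.2 ⟨d * a, mul_ne_zero hd fun h0 => ha (by rw [h0, map_zero]), ?_⟩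
    rw [mul_assoc, h, mul_assoc]
  exact
    { mul_left_cancel_of_ne_zero := fun {a} ha b c h => key a b c ha h
      mul_right_cancel_of_ne_zero := fun {a} ha b c h =>
        key a b c ha (by simpa only [mul_comm a] using h) }

end CancelReduction

/-! ### Composition of reduced correspondences -/

namespace ReducedCorrespondence

variable (C D : ReducedCorrespondence.{u})

instance : Nontrivial C.carrier := by
  refine ⟨⟨1, 0, fun h => ?_⟩⟩
  have : (1 : ZMinPlus) ∈ C.left ⁻¹' {0} := by simpa using h
  rw [C.left_preimage_zero] at this
  have h0 : (0 : ℕ∞) = ⊤ := congrArg Tropical.untrop (Set.mem_singleton_iff.1 this)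
  exact ENat.zero_ne_top h0

theorem one_add_one : (1 : C.carrier) + 1 = 1 := by
  rw [← map_one C.left, ← map_add, ZMinPlus.one_add_one]

/-- `R` regarded as an algebra over `ℤ_min^+` by means of `r`. -/
def ViaRight : Type u := C.carrier

/-- `R` regarded as an algebra over `ℤ_min^+` by means of `ℓ`. -/
def ViaLeft : Type u := C.carrier

instance : CommSemiring C.ViaRight := inferInstanceAs (CommSemiring C.carrier)
instance : CommSemiring C.ViaLeft := inferInstanceAs (CommSemiring C.carrier)
instance : IsCancelMulZero C.ViaRight := inferInstanceAs (IsCancelMulZero C.carrier)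
instance : IsCancelMulZero C.ViaLeft := inferInstanceAs (IsCancelMulZero C.carrier)
instance : Nontrivial C.ViaRight := inferInstanceAs (Nontrivial C.carrier)
instance : Nontrivial C.ViaLeft := inferInstanceAs (Nontrivial C.carrier)
instance : Algebra ZMinPlus C.ViaRight := RingHom.toAlgebra C.right
instance : Algebra ZMinPlus C.ViaLeft := RingHom.toAlgebra C.left

/-- The identity map `R → R`, with values in the algebra given by `r`. -/
def toViaRight : C.carrier ≃+* C.ViaRight := RingEquiv.refl _

/-- The identity map `R → R`, with values in the algebra given by `ℓ`. -/
def toViaLeft : C.carrier ≃+* C.ViaLeft := RingEquiv.refl _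

/-- The semiring `R ⊗_{ℤ_min^+} R'`, where `ℤ_min^+` acts on `R` by `r` and on `R'` by `ℓ'`. -/
abbrev Tensor : Type u := C.ViaRight ⊗[ZMinPlus] D.ViaLeft

/-- The tensor product is an integral semiring: the supports of the two factors define a character
to `𝔹` with trivial kernel. -/
theorem exists_character : ∃ f : Tensor C D →+* BoolSemifield, (∀ t, f t = 0 → t = 0) ∧
    ∀ (a : C.ViaRight) (b : D.ViaLeft), f (a ⊗ₜ[ZMinPlus] b) = 0 → a = 0 ∨ b = 0 := by
  let s : ZMinPlus →+* BoolSemifield := (BoolSemifield.support C.carrier C.one_add_one).comp C.right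
  let _ : Algebra ZMinPlus BoolSemifield := s.toAlgebra
  have hs : ∀ x, s x = 0 ↔ x = 0 := fun x => by
    have : C.right x = 0 ↔ x = 0 := by
      have := Set.ext_iff.1 C.right_preimage_zero x
      simpa using this
    rw [← this]
    exact BoolSemifield.support_eq_zero C.one_add_one _
  have hb : ∀ a b : BoolSemifield, (a = 0 ↔ b = 0) → a = b := by decide
  let f : C.ViaRight →ₐ[ZMinPlus] BoolSemifield :=
    { BoolSemifield.support C.ViaRight C.one_add_one with commutes' := fun _ => rfl }
  let g : D.ViaLeft →ₐ[ZMinPlus] BoolSemifield :=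
    { BoolSemifield.support D.ViaLeft D.one_add_one with
      commutes' := fun x => hb _ _ <| by
        have h1 : D.left x = 0 ↔ x = 0 := by
          have := Set.ext_iff.1 D.left_preimage_zero x
          simpa using this
        refine Iff.trans ?_ (hs x).symm
        rw [← h1]
        exact BoolSemifield.support_eq_zero D.one_add_one _ }
  have hadd : ∀ a b : BoolSemifield, a + b = 0 → a = 0 ∧ b = 0 := by decide
  have hmul : ∀ a b : BoolSemifield, a * b = 0 → a = 0 ∨ b = 0 := by decide
  have htmul : ∀ (a : C.ViaRight) (b : D.ViaLeft),
      (Algebra.TensorProduct.productMap f g).toRingHom (a ⊗ₜ[ZMinPlus] b) = 0 →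
        a = 0 ∨ b = 0 := by
    intro a b h
    have h' : f a * g b = 0 := by simpa using h
    exact (hmul _ _ h').imp (BoolSemifield.support_eq_zero C.one_add_one a).1
      (BoolSemifield.support_eq_zero D.one_add_one b).1
  refine ⟨(Algebra.TensorProduct.productMap f g).toRingHom, fun t => ?_, htmul⟩
  induction t using TensorProduct.induction_on with
  | zero => exact fun _ => rfl
  | tmul a b =>
    intro h
    rcases htmul a b h with h0 | h0
    · rw [h0, TensorProduct.zero_tmul]
    · rw [h0, TensorProduct.tmul_zero]
  | add x y hx hy =>
    intro h
    rw [map_add] at h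
    rw [hx (hadd _ _ h).1, hy (hadd _ _ h).2, add_zero]

instance : NoZeroDivisors (Tensor C D) := by
  obtain ⟨f, hf, -⟩ := exists_character C D
  have hmul : ∀ a b : BoolSemifield, a * b = 0 → a = 0 ∨ b = 0 := by decide
  refine ⟨fun {a b} h => ?_⟩
  have := congrArg f h
  rw [map_mul, map_zero] at this
  exact (hmul _ _ this).imp (hf a) (hf b)

instance : Nontrivial (Tensor C D) := by
  obtain ⟨f, -, -⟩ := exists_character C D
  have h10 : (1 : BoolSemifield) ≠ 0 := by decide
  exact ⟨⟨1, 0, fun h => h10 (by rw [← map_one f, h, map_zero])⟩⟩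

/-- The morphism `ℓ ⊗ Id` from `ℤ_min^+` to the cancellative reduction of `R ⊗ R'`. -/
noncomputable def tensorLeft : ZMinPlus →+* CancelReduction (Tensor C D) :=
  (cancelCon (Tensor C D)).mk'.comp
    ((Algebra.TensorProduct.includeLeftRingHom).comp (C.toViaRight.toRingHom.comp C.left))

/-- The morphism `Id ⊗ r'` from `ℤ_min^+` to the cancellative reduction of `R ⊗ R'`. -/
noncomputable def tensorRight : ZMinPlus →+* CancelReduction (Tensor C D) :=
  (cancelCon (Tensor C D)).mk'.comp
    ((Algebra.TensorProduct.includeRight.toRingHom).comp (D.toViaLeft.toRingHom.comp D.right))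

theorem tmul_eq_zero {a : C.ViaRight} {b : D.ViaLeft}
    (h : (a ⊗ₜ[ZMinPlus] b : Tensor C D) = 0) : a = 0 ∨ b = 0 := by
  obtain ⟨f, -, hf⟩ := exists_character C D
  exact hf a b (by rw [h, map_zero])

theorem tensorLeft_eq_zero (x : ZMinPlus) (h : tensorLeft C D x = 0) : x = 0 := by
  have h1 := tmul_eq_zero C D (cancelCon_mk_eq_zero.1 h)
  have h2 : C.left x = 0 := h1.resolve_right one_ne_zero
  have h3 : x ∈ C.left ⁻¹' {0} := h2
  rwa [C.left_preimage_zero] at h3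

theorem tensorRight_eq_zero (x : ZMinPlus) (h : tensorRight C D x = 0) : x = 0 := by
  have h1 := tmul_eq_zero C D (cancelCon_mk_eq_zero.1 h)
  have h2 : D.right x = 0 := h1.resolve_left one_ne_zero
  have h3 : x ∈ D.right ⁻¹' {0} := h2
  rwa [D.right_preimage_zero] at h3

/-- The reduced correspondence carried by a sub-semiring `T` of a semiring `R`, when `T` is
multiplicatively cancellative and is generated by the products `ℓ(x) r(y)`. -/
def ofSubsemiring {R : Type u} [CommSemiring R] (T : Subsemiring R) (l r : ZMinPlus →+* R)
    (hcancel : ∀ a ∈ T, ∀ b ∈ T, ∀ c ∈ T, a ≠ 0 → a * b = a * c → b = c)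
    (hl : ∀ x, l x ∈ T) (hr : ∀ x, r x ∈ T)
    (hl0 : ∀ x, l x = 0 → x = 0) (hr0 : ∀ x, r x = 0 → x = 0)
    (hgen : T ≤ Subsemiring.closure {z | ∃ x y, z = l x * r y}) :
    ReducedCorrespondence.{u} where
  carrier := T
  isCancelMulZero :=
    have key : ∀ a b c : T, a ≠ 0 → a * b = a * c → b = c := fun a b c ha h =>
      Subtype.ext (hcancel a a.2 b b.2 c c.2 (fun h0 => ha (Subtype.ext h0))
        (congrArg Subtype.val h))
    { mul_left_cancel_of_ne_zero := fun {a} ha b c h => key a b c ha h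
      mul_right_cancel_of_ne_zero := fun {a} ha b c h =>
        key a b c ha (by simpa only [mul_comm a] using h) }
  left := l.codRestrict T hl
  right := r.codRestrict T hr
  left_preimage_zero := by
    ext x
    refine ⟨fun h => hl0 x (congrArg Subtype.val (Set.mem_singleton_iff.1 h)), fun h => ?_⟩
    rw [Set.mem_singleton_iff.1 h]
    exact map_zero _
  right_preimage_zero := by
    ext x
    refine ⟨fun h => hr0 x (congrArg Subtype.val (Set.mem_singleton_iff.1 h)), fun h => ?_⟩
    rw [Set.mem_singleton_iff.1 h]
    exact map_zero _
  generated := by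
    rw [eq_top_iff]
    intro z _
    have hz : (z : R) ∈ (Subsemiring.closure {z : T | ∃ x y,
        z = l.codRestrict T hl x * r.codRestrict T hr y}).map T.subtype := by
      rw [RingHom.map_closureS]
      refine Subsemiring.closure_mono ?_ (hgen z.2)
      rintro _ ⟨x, y, rfl⟩
      exact ⟨_, ⟨x, y, rfl⟩, rfl⟩
    obtain ⟨w, hw, h⟩ := hz
    rwa [Subtype.ext h] at hw

/-- The composition `(R, ℓ, r) ∘ (R', ℓ', r')`: the sub-semiring, generated by the images of
`ℓ ⊗ Id` and `Id ⊗ r'`, of the multiplicatively cancellative reduction of `R ⊗_{ℤ_min^+} R'`. -/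
noncomputable def comp : ReducedCorrespondence.{u} :=
  ofSubsemiring
    (Subsemiring.closure (Set.range (tensorLeft C D) ∪ Set.range (tensorRight C D)))
    (tensorLeft C D) (tensorRight C D)
    (fun _ _ _ _ _ _ ha h => mul_left_cancel₀ ha h)
    (fun x => Subsemiring.subset_closure (Or.inl ⟨x, rfl⟩))
    (fun x => Subsemiring.subset_closure (Or.inr ⟨x, rfl⟩))
    (tensorLeft_eq_zero C D) (tensorRight_eq_zero C D)
    (Subsemiring.closure_mono (by
      rintro _ (⟨x, rfl⟩ | ⟨x, rfl⟩)
      · exact ⟨x, 1, by rw [map_one, mul_one]⟩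
      · exact ⟨1, x, by rw [map_one, one_mul]⟩))

end ReducedCorrespondence

/-! ### The Frobenius correspondences -/

section Frobenius

variable (q : ℝ≥0) (hq0 : 0 < q) (hq1 : q < 1) (lam : ℝ) (hlam : 0 < lam)

/-- The semiring morphism `ℤ_min^+ → ℝ_+^max`, `q^n ↦ q^(s n)`, for `s ≥ 0`. -/
noncomputable def scaleHom (s : ℝ) (hs : 0 ≤ s) : ZMinPlus →+* RMax :=
  powHom RMax.one_add_one (RMax.qpow q s) (RMax.qpow_add_one hq1 hs)

theorem scaleHom_eq_zero (hq0 : 0 < q) (s : ℝ) (hs : 0 ≤ s) (x : ZMinPlus)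
    (hx : scaleHom q hq1 s hs x = 0) : x = 0 := by
  refine powHom_eq_zero _ _ _ (fun n => ?_) x hx
  induction n with
  | zero => exact fun h => one_ne_zero (congrArg RMax.val h)
  | succ n ih =>
    intro h
    rw [pow_succ, ← mul_zero (RMax.qpow q s ^ n)] at h
    exact RMax.qpow_ne_zero hq0 s (RMax.mul_left_cancel_of_ne ih h)

/-- A morphism between semirings of characteristic one is `𝔹`-linear. -/
noncomputable def scaleAlgHom (s : ℝ) (hs : 0 ≤ s) : ZMinPlus →ₐ[BoolSemifield] RMax :=
  { scaleHom q hq1 s hs with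
    commutes' := fun a => by
      have h : ∀ a : BoolSemifield, a = 0 ∨ a = 1 := by decide
      rcases h a with rfl | rfl
      · simp
      · simp }

@[simp] theorem scaleAlgHom_apply (s : ℝ) (hs : 0 ≤ s) (x : ZMinPlus) :
    scaleAlgHom q hq1 s hs x = scaleHom q hq1 s hs x := rfl

/-- The morphism `𝓕(λ, q) : ℤ_min^+ ⊗_𝔹 ℤ_min^+ → ℝ_+^max`,
`∑ q^(n_i) ⊗ q^(m_i) ↦ q^α`, `α = inf (λ n_i + m_i)`. -/
noncomputable def frobF : ZMinPlus ⊗[BoolSemifield] ZMinPlus →+* RMax :=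
  (Algebra.TensorProduct.productMap (scaleAlgHom q hq1 lam hlam.le)
    (scaleAlgHom q hq1 1 zero_le_one)).toRingHom

/-- The Frobenius correspondence `Ψ(λ) = (𝓡(λ), 𝓕(λ) ∘ ι₁, 𝓕(λ) ∘ ι₂)`, where `𝓡(λ)` is the range
of `𝓕(λ, q)`, `ι₁(x) = x ⊗ 1` and `ι₂(x) = 1 ⊗ x`. -/
noncomputable def frobenius : ReducedCorrespondence.{0} :=
  ReducedCorrespondence.ofSubsemiring (frobF q hq1 lam hlam).rangeS
    ((frobF q hq1 lam hlam).comp Algebra.TensorProduct.includeLeftRingHom)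
    ((frobF q hq1 lam hlam).comp Algebra.TensorProduct.includeRight.toRingHom)
    (fun _ _ _ _ _ _ ha h => RMax.mul_left_cancel_of_ne ha h)
    (fun x => ⟨x ⊗ₜ 1, rfl⟩) (fun x => ⟨1 ⊗ₜ x, rfl⟩)
    (fun x hx => scaleHom_eq_zero q hq1 hq0 lam hlam.le x (by simpa [frobF] using hx))
    (fun x hx => scaleHom_eq_zero q hq1 hq0 1 zero_le_one x (by simpa [frobF] using hx))
    (by
      rintro _ ⟨t, rfl⟩
      induction t using TensorProduct.induction_on with
      | zero => rw [map_zero]; exact Subsemiring.zero_mem _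
      | tmul a b =>
        refine Subsemiring.subset_closure ⟨a, b, ?_⟩
        rw [RingHom.comp_apply, RingHom.comp_apply, ← map_mul]
        simp
      | add x y hx hy => rw [map_add]; exact Subsemiring.add_mem _ hx hy)

end Frobenius

/-! ### The tangential deformation of the identity -/

/-- The semiring `Germ_{ε = 0}(ℝ_+^max)` of germs at `0 ∈ ℝ` of functions with values in `ℝ_+^max`
which are continuous in a neighborhood of `0`, with the pointwise operations. -/
def contGerm : Subsemiring (Filter.Germ (𝓝 (0 : ℝ)) RMax) where
  carrier := {g | ∃ f : ℝ → RMax, (∀ᶠ e in 𝓝 (0 : ℝ), ContinuousAt f e) ∧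
    g = (f : Filter.Germ (𝓝 (0 : ℝ)) RMax)}
  zero_mem' := ⟨0, Filter.Eventually.of_forall fun _ => continuousAt_const, rfl⟩
  one_mem' := ⟨1, Filter.Eventually.of_forall fun _ => continuousAt_const, rfl⟩
  add_mem' := by
    rintro _ _ ⟨f, hf, rfl⟩ ⟨g, hg, rfl⟩
    exact ⟨f + g, (hf.and hg).mono fun _ h => h.1.add h.2, rfl⟩
  mul_mem' := by
    rintro _ _ ⟨f, hf, rfl⟩ ⟨g, hg, rfl⟩
    exact ⟨f * g, (hf.and hg).mono fun _ h => h.1.mul h.2, rfl⟩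

section Deformation

variable (q : ℝ≥0) (hq0 : 0 < q) (hq1 : q < 1)

theorem continuous_qpow (hq0 : 0 < q) {s : ℝ → ℝ} (hs : Continuous s) :
    Continuous fun e => RMax.qpow q (s e) :=
  continuous_induced_rng.2 (continuous_iff_continuousAt.2 fun _ =>
    continuousAt_const.nnrpow hs.continuousAt (Or.inl hq0.ne'))

/-- The germ at `ε = 0` of the function `ε ↦ q^(s(ε))`, for a continuous exponent `s`. -/
noncomputable def qgerm (s : ℝ → ℝ) (hs : Continuous s) : contGerm :=
  ⟨((fun e => RMax.qpow q (s e) : ℝ → RMax) : Filter.Germ (𝓝 (0 : ℝ)) RMax),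
    _, Filter.Eventually.of_forall fun _ => (continuous_qpow q hq0 hs).continuousAt, rfl⟩

/-- The germ of the constant function `q`. -/
noncomputable def qConst : contGerm := qgerm q hq0 (fun _ => 1) continuous_const

/-- The germ `θ_{1+ε}(q) = q^(1+ε)`. -/
noncomputable def qDeform : contGerm :=
  qgerm q hq0 (fun e => 1 + e) (continuous_const.add continuous_id)

/-- The sub-semiring `𝓡_ε` of `Germ_{ε = 0}(ℝ_+^max)` generated by `q` and `q^(1+ε)`. -/
noncomputable def deformedSemiring : Subsemiring contGerm :=
  Subsemiring.closure {qConst q hq0, qDeform q hq0}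

theorem contGerm_one_add_one : (1 : contGerm) + 1 = 1 :=
  Subtype.ext (congrArg (fun f : ℝ → RMax => (f : Filter.Germ (𝓝 (0 : ℝ)) RMax))
    (funext fun _ => RMax.one_add_one))

theorem qgerm_add_one (hq1 : q < 1) (s : ℝ → ℝ) (hs : Continuous s)
    (hs0 : ∀ᶠ e in 𝓝 (0 : ℝ), 0 ≤ s e) : qgerm q hq0 s hs + 1 = 1 :=
  Subtype.ext (Filter.Germ.coe_eq.2 (hs0.mono fun _ he => RMax.qpow_add_one hq1 he))

theorem qConst_add_one (hq1 : q < 1) : qConst q hq0 + 1 = 1 :=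
  qgerm_add_one q hq0 hq1 _ _ (Filter.Eventually.of_forall fun _ => zero_le_one)

theorem qDeform_add_one (hq1 : q < 1) : qDeform q hq0 + 1 = 1 :=
  qgerm_add_one q hq0 hq1 _ _ (by
    filter_upwards [Ioi_mem_nhds (show (-1 : ℝ) < 0 by norm_num)] with e he
    have : (-1 : ℝ) < e := he
    linarith)

/-- The germ `x` has no zero in a neighborhood of `0`. -/
def NonvanishingGerm (x : contGerm) : Prop :=
  ∃ f : ℝ → RMax, (∀ᶠ e in 𝓝 (0 : ℝ), f e ≠ 0) ∧
    (x : Filter.Germ (𝓝 (0 : ℝ)) RMax) = (f : Filter.Germ (𝓝 (0 : ℝ)) RMax)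

theorem NonvanishingGerm.mul {x y : contGerm} (hx : NonvanishingGerm x)
    (hy : NonvanishingGerm y) : NonvanishingGerm (x * y) := by
  obtain ⟨f, hf, hxf⟩ := hx
  obtain ⟨g, hg, hyg⟩ := hy
  refine ⟨f * g, ?_, ?_⟩
  · filter_upwards [hf, hg] with e h1 h2 h
    exact h2 (RMax.mul_left_cancel_of_ne h1 (h.trans (mul_zero _).symm))
  · change (x : Filter.Germ (𝓝 (0 : ℝ)) RMax) * (y : Filter.Germ (𝓝 (0 : ℝ)) RMax) = _
    rw [hxf, hyg]
    rfl

theorem NonvanishingGerm.add {x y : contGerm} (hx : NonvanishingGerm x)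
    (hy : NonvanishingGerm y) : NonvanishingGerm (x + y) := by
  obtain ⟨f, hf, hxf⟩ := hx
  obtain ⟨g, hg, hyg⟩ := hy
  refine ⟨f + g, ?_, ?_⟩
  · filter_upwards [hf] with e h1 h
    have h2 : max (f e).val (g e).val = 0 := congrArg RMax.val h
    exact h1 (RMax.ext (le_antisymm ((le_max_left _ _).trans h2.le) zero_le))
  · change (x : Filter.Germ (𝓝 (0 : ℝ)) RMax) + (y : Filter.Germ (𝓝 (0 : ℝ)) RMax) = _
    rw [hxf, hyg]
    rfl

theorem NonvanishingGerm.one : NonvanishingGerm 1 :=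
  ⟨1, Filter.Eventually.of_forall fun _ h => one_ne_zero (congrArg RMax.val h), rfl⟩

theorem NonvanishingGerm.pow {x : contGerm} (hx : NonvanishingGerm x) (n : ℕ) :
    NonvanishingGerm (x ^ n) := by
  induction n with
  | zero => rw [pow_zero]; exact .one
  | succ n ih => rw [pow_succ]; exact ih.mul hx

theorem NonvanishingGerm.ne_zero {x : contGerm} (hx : NonvanishingGerm x) : x ≠ 0 := by
  rintro rfl
  obtain ⟨f, hf, h⟩ := hx
  obtain ⟨e, h1, h2⟩ := (hf.and (Filter.Germ.coe_eq.1 h)).exists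
  exact h1 h2.symm

theorem NonvanishingGerm.mul_left_cancel {x y z : contGerm} (hx : NonvanishingGerm x)
    (h : x * y = x * z) : y = z := by
  obtain ⟨f, hf, hxf⟩ := hx
  obtain ⟨g, -, hg⟩ := y.2
  obtain ⟨k, -, hk⟩ := z.2
  have h' : (x : Filter.Germ (𝓝 (0 : ℝ)) RMax) * (y : Filter.Germ (𝓝 (0 : ℝ)) RMax)
      = (x : Filter.Germ (𝓝 (0 : ℝ)) RMax) * (z : Filter.Germ (𝓝 (0 : ℝ)) RMax) :=
    congrArg Subtype.val h
  rw [hxf, hg, hk] at h'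
  refine Subtype.ext ?_
  rw [hg, hk]
  refine Filter.Germ.coe_eq.2 ?_
  filter_upwards [hf, Filter.Germ.coe_eq.1 h'] with e h1 h2
  exact RMax.mul_left_cancel_of_ne h1 h2

theorem qgerm_nonvanishing (s : ℝ → ℝ) (hs : Continuous s) :
    NonvanishingGerm (qgerm q hq0 s hs) :=
  ⟨_, Filter.Eventually.of_forall fun e => RMax.qpow_ne_zero hq0 (s e), rfl⟩

theorem deformedSemiring_nonvanishing (x : contGerm) (hx : x ∈ deformedSemiring q hq0) :
    x = 0 ∨ NonvanishingGerm x := by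
  induction hx using Subsemiring.closure_induction with
  | mem x hx =>
    rcases hx with rfl | rfl
    · exact Or.inr (qgerm_nonvanishing q hq0 _ _)
    · exact Or.inr (qgerm_nonvanishing q hq0 _ _)
  | zero => exact Or.inl rfl
  | one => exact Or.inr .one
  | add x y _ _ hx hy =>
    rcases hx with rfl | hx
    · simpa using hy
    rcases hy with rfl | hy
    · simpa using Or.inr hx
    · exact Or.inr (hx.add hy)
  | mul x y _ _ hx hy =>
    rcases hx with rfl | hx
    · exact Or.inl (zero_mul y)
    rcases hy with rfl | hy
    · exact Or.inl (mul_zero x)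
    · exact Or.inr (hx.mul hy)

/-- The tangential deformation `Id_ε = (𝓡_ε, ℓ_ε, r_ε)` of the identity correspondence:
`ℓ_ε(q^n) = θ_{1+ε}(q^n) = q^((1+ε) n)` and `r_ε(q^n) = q^n`. -/
noncomputable def idDeform : ReducedCorrespondence.{0} :=
  ReducedCorrespondence.ofSubsemiring (deformedSemiring q hq0)
    (powHom contGerm_one_add_one (qDeform q hq0) (qDeform_add_one q hq0 hq1))
    (powHom contGerm_one_add_one (qConst q hq0) (qConst_add_one q hq0 hq1))
    (fun a ha _ _ _ _ ha0 h =>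
      ((deformedSemiring_nonvanishing q hq0 a ha).resolve_left ha0).mul_left_cancel h)
    (powHom_mem _ _ _ _ (Subsemiring.subset_closure (by simp)))
    (powHom_mem _ _ _ _ (Subsemiring.subset_closure (by simp)))
    (powHom_eq_zero _ _ _ fun n => ((qgerm_nonvanishing q hq0 _ _).pow n).ne_zero)
    (powHom_eq_zero _ _ _ fun n => ((qgerm_nonvanishing q hq0 _ _).pow n).ne_zero)
    (Subsemiring.closure_mono (by
      rintro _ (rfl | rfl)
      · exact ⟨1, Tropical.trop 1, by
          rw [map_one, one_mul]; exact (powHom_trop_one _ _ _).symm⟩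
      · exact ⟨Tropical.trop 1, 1, by
          rw [map_one, mul_one]; exact (powHom_trop_one _ _ _).symm⟩))

end Deformation

end ArithmeticSite

/-!
In a multiplicatively cancellative semiring of characteristic one, `a ^ N ≤ b ^ N` implies `a ≤ b`.
In a composition, the products of `x = q^(λλ')` and `z = q` can therefore be compared by inserting
powers of the intermediate variable `y = q^(λ')`, which is shared by the two factors: two
monomials of different weights are always ordered as in `ℝ_+^max`, and when `λ` is rational so are
monomials of the same weight. Together with the fact that no two monomials have the same weight if
`λλ'` is irrational, this determines the composition in the first two cases.

If `λ` is irrational, there is an additive map `D : ℝ → ℝ` with `D 1 = 1` and `D (1 / λ) = 0`, and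
`q^s ↦ q^(s + ε D(s))` is a morphism from `ℝ_+^max` to germs at `ε = 0`. Normalizing the weights of
`x, y, z` to be `1, 1 / λ, 1 / (λλ')`, one deforms the first factor by `D` and leaves the second one
constant; both agree on `y`. This separates monomials of the same weight as in `Id_ε`. The
morphism is injective because a monomial whose exponent of `x` lies between those of two others of
the same weight is bounded by their sum.
-/

namespace ArithmeticSite

universe u v

/-! ### Monomials in idempotent semirings -/

section Idempotent

/-- A commutative semiring of characteristic one, ordered by `a ≤ b ↔ a + b = b`. -/
abbrev idemCommSemiring {R : Type u} [CommSemiring R] (h : (1 : R) + 1 = 1) :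
    IdemCommSemiring R :=
  { ‹CommSemiring R›, IdemSemiring.ofSemiring (fun a : R => by
      rw [← mul_one a, ← mul_add, h]) with }

variable {K : Type u} [IdemCommSemiring K]

theorem ne_zero_of_le {a b : K} (h : a ≤ b) (ha : a ≠ 0) : b ≠ 0 := by
  rintro rfl
  exact ha (le_antisymm h zero_le)

variable [IsCancelMulZero K]

theorem le_of_mul_le_mul_of_ne_zero {s a b : K} (hs : s ≠ 0) (h : s * a ≤ s * b) : a ≤ b := by
  rw [← add_eq_right_iff_le] at h ⊢
  rw [← mul_add] at h
  exact mul_left_cancel₀ hs h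

open Finset in
theorem le_of_pow_le_pow_of_ne_zero {a b : K} (hb : b ≠ 0) {N : ℕ} (hN : N ≠ 0)
    (h : a ^ N ≤ b ^ N) : a ≤ b := by
  obtain ⟨N, rfl⟩ := Nat.exists_eq_succ_of_ne_zero hN
  set s := ∑ ij ∈ antidiagonal N, a ^ ij.1 * b ^ ij.2 with hs
  have hle : b ^ N ≤ s := by
    simpa using single_le_sum (f := fun ij : ℕ × ℕ => a ^ ij.1 * b ^ ij.2)
      (fun _ _ => zero_le) (show (0, N) ∈ antidiagonal N by simp)
  -- Both sides are the sum of all `a ^ i * b ^ j` with `i + j = N + 1`.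
  have hsum : s * a + b ^ (N + 1) = s * b + a ^ (N + 1) := by
    have h₁ := Nat.sum_antidiagonal_succ (n := N) (f := fun ij => a ^ ij.1 * b ^ ij.2)
    have h₂ := Nat.sum_antidiagonal_succ' (n := N) (f := fun ij => a ^ ij.1 * b ^ ij.2)
    simp only [pow_succ, pow_zero, one_mul, mul_one, ← mul_assoc, mul_right_comm _ a,
      ← sum_mul, ← hs] at h₁ h₂ ⊢
    rw [add_comm, ← h₁, h₂, add_comm]
  refine le_of_mul_le_mul_of_ne_zero (ne_zero_of_le hle (pow_ne_zero N hb)) ?_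
  calc s * a ≤ s * a + b ^ (N + 1) := le_self_add
    _ = s * b + a ^ (N + 1) := hsum
    _ ≤ s * b + s * b := add_le_add le_rfl (h.trans (pow_succ b N ▸ mul_le_mul' hle le_rfl))
    _ = s * b := add_idem _

theorem le_add_of_pow_add_eq {a b c : K} (hb : b ≠ 0) {i j : ℕ} (hij : i + j ≠ 0)
    (h : a ^ (i + j) = b ^ i * c ^ j) : a ≤ b + c := by
  refine le_of_pow_le_pow_of_ne_zero (ne_zero_of_le le_self_add hb) hij ?_
  rw [h, pow_add]
  exact mul_le_mul' (pow_le_pow_left' le_self_add i) (pow_le_pow_left' le_add_self j)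

end Idempotent

section Weight

variable {K : Type u} {L : Type v} [IdemCommSemiring K] [IdemCommSemiring L]

/-- The order of the monomials `x ^ n * y ^ m` is the reverse of that of their weights
`a * n + b * m`, as happens for `x = q ^ a` and `y = q ^ b` with `q < 1`. -/
def IsWeight (x y : K) (a b : ℝ) : Prop :=
  ∀ ⦃n m n' m' : ℕ⦄, a * n + b * m ≤ a * n' + b * m' → x ^ n' * y ^ m' ≤ x ^ n * y ^ m

/-- As `IsWeight`, but monomials of equal weight are not compared. -/
def IsWeakWeight (x y : K) (a b : ℝ) : Prop :=
  ∀ ⦃n m n' m' : ℕ⦄, a * n + b * m < a * n' + b * m' → x ^ n' * y ^ m' ≤ x ^ n * y ^ m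

theorem IsWeight.isWeakWeight {x y : K} {a b : ℝ} (h : IsWeight x y a b) :
    IsWeakWeight x y a b :=
  fun _ _ _ _ hlt => h hlt.le

theorem map_mono (f : K →+* L) : Monotone f := fun a b h => by
  rw [← add_eq_right_iff_le] at h ⊢
  rw [← map_add, h]

theorem map_le_map_iff_of_injective {f : K →+* L} (hf : Function.Injective f) {a b : K} :
    f a ≤ f b ↔ a ≤ b := by
  rw [← add_eq_right_iff_le, ← map_add, hf.eq_iff, add_eq_right_iff_le]

theorem IsWeight.map (f : K →+* L) {x y : K} {a b : ℝ} (h : IsWeight x y a b) :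
    IsWeight (f x) (f y) a b := fun n m n' m' hle => by
  simpa only [map_mul, map_pow] using map_mono f (h hle)

theorem IsWeakWeight.map (f : K →+* L) {x y : K} {a b : ℝ} (h : IsWeakWeight x y a b) :
    IsWeakWeight (f x) (f y) a b := fun n m n' m' hlt => by
  simpa only [map_mul, map_pow] using map_mono f (h hlt)

theorem IsWeight.of_map {f : K →+* L} (hf : Function.Injective f) {x y : K} {a b : ℝ}
    (h : IsWeight (f x) (f y) a b) : IsWeight x y a b := fun n m n' m' hle => by
  rw [← map_le_map_iff_of_injective hf]
  simpa only [map_mul, map_pow] using h hle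

theorem IsWeakWeight.of_map {f : K →+* L} (hf : Function.Injective f) {x y : K} {a b : ℝ}
    (h : IsWeakWeight (f x) (f y) a b) : IsWeakWeight x y a b := fun n m n' m' hlt => by
  rw [← map_le_map_iff_of_injective hf]
  simpa only [map_mul, map_pow] using h hlt

theorem IsWeight.mul_right {x y : K} {a b c : ℝ} (h : IsWeight x y a b) (hc : 0 < c) :
    IsWeight x y (a * c) (b * c) := fun n m n' m' hle =>
  h (le_of_mul_le_mul_right (by linear_combination hle) hc)

theorem eq_and_eq_of_irrational_div {a b : ℝ} (h : Irrational (a / b)) {n m n' m' : ℕ}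
    (heq : a * n + b * m = a * n' + b * m') : n = n' ∧ m = m' := by
  have hb : b ≠ 0 := by
    rintro rfl
    exact h ⟨0, by simp⟩
  have hn : n = n' := by
    by_contra hne
    have hne' : (n : ℝ) - n' ≠ 0 := sub_ne_zero.2 (by exact_mod_cast hne)
    refine h ⟨((m' : ℚ) - m) / (n - n'), ?_⟩
    push_cast
    rw [div_eq_div_iff hne' hb]
    linarith
  subst hn
  exact ⟨rfl, by exact_mod_cast mul_left_cancel₀ hb (add_left_cancel heq)⟩

theorem IsWeakWeight.isWeight_of_irrational {x y : K} {a b : ℝ} (h : IsWeakWeight x y a b)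
    (hab : Irrational (a / b)) : IsWeight x y a b := fun n m n' m' hle => by
  rcases hle.lt_or_eq with hlt | heq
  · exact h hlt
  · obtain ⟨rfl, rfl⟩ := eq_and_eq_of_irrational_div hab heq
    exact le_rfl

theorem exists_nat_cast_mul_eq_sub (r : ℚ) :
    ∃ N k k' : ℕ, N ≠ 0 ∧ (N : ℝ) * r = (k' : ℝ) - k := by
  refine ⟨r.den, (-r.num).toNat, r.num.toNat, r.den_nz, ?_⟩
  have h : (r.den : ℝ) * r = r.num := by exact_mod_cast Rat.den_mul_eq_num r
  rw [h, ← Int.toNat_sub_toNat_neg r.num]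
  push_cast
  simp

variable [IsCancelMulZero K] {x y z : K} {a b c : ℝ}

theorem pow_mul_pow_le_of_interpolation (hx : x ≠ 0) (hy : y ≠ 0) (hz : z ≠ 0)
    {n m n' m' N k k' : ℕ} (hN : N ≠ 0)
    (hxy : x ^ (N * n') * y ^ k ≤ x ^ (N * n) * y ^ k')
    (hyz : y ^ k' * z ^ (N * m') ≤ y ^ k * z ^ (N * m)) :
    x ^ n' * z ^ m' ≤ x ^ n * z ^ m := by
  refine le_of_pow_le_pow_of_ne_zero (mul_ne_zero (pow_ne_zero n hx) (pow_ne_zero m hz)) hN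
    (le_of_mul_le_mul_of_ne_zero (mul_ne_zero (pow_ne_zero k hy) (pow_ne_zero k' hy)) ?_)
  calc y ^ k * y ^ k' * (x ^ n' * z ^ m') ^ N
      = (x ^ (N * n') * y ^ k) * (y ^ k' * z ^ (N * m')) := by rw [mul_pow]; ring
    _ ≤ (x ^ (N * n) * y ^ k') * (y ^ k * z ^ (N * m)) := mul_le_mul' hxy hyz
    _ = y ^ k * y ^ k' * (x ^ n * z ^ m) ^ N := by rw [mul_pow]; ring

theorem IsWeakWeight.trans (hx : x ≠ 0) (hy : y ≠ 0) (hz : z ≠ 0) (hb : 0 < b)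
    (hxy : IsWeakWeight x y a b) (hyz : IsWeakWeight y z b c) : IsWeakWeight x z a c := by
  intro n m n' m' hlt
  obtain ⟨r, hr₁, hr₂⟩ : ∃ r : ℚ, c * (m - m') / b < r ∧ (r : ℝ) < a * (n' - n) / b :=
    exists_rat_btwn ((div_lt_div_iff_of_pos_right hb).2 (by linarith))
  rw [div_lt_iff₀ hb] at hr₁
  rw [lt_div_iff₀ hb] at hr₂
  obtain ⟨N, k, k', hN, hk⟩ := exists_nat_cast_mul_eq_sub r
  have hN' : (0 : ℝ) < N := by positivity
  refine pow_mul_pow_le_of_interpolation (k := k) (k' := k') hx hy hz hN (hxy ?_) (hyz ?_)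
  · have := mul_lt_mul_of_pos_left hr₂ hN'
    push_cast
    linear_combination this - b * hk
  · have := mul_lt_mul_of_pos_left hr₁ hN'
    push_cast
    linear_combination this + b * hk

theorem IsWeight.trans_of_rat (hx : x ≠ 0) (hy : y ≠ 0) (hz : z ≠ 0) {r : ℚ} (hab : a = r * b)
    (hxy : IsWeight x y a b) (hyz : IsWeight y z b c) : IsWeight x z a c := by
  intro n m n' m' hle
  obtain ⟨N, k, k', hN, hk⟩ := exists_nat_cast_mul_eq_sub (r * (n' - n))
  push_cast at hk
  refine pow_mul_pow_le_of_interpolation (k := k) (k' := k') hx hy hz hN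
    (hxy (le_of_eq ?_)) (hyz ?_)
  · push_cast
    linear_combination -b * hk - N * (n' - n) * hab
  · have := mul_le_mul_of_nonneg_left hle (Nat.cast_nonneg (α := ℝ) N)
    push_cast
    linear_combination this + b * hk + N * (n' - n) * hab

theorem pow_mul_pow_le_add_of_between (hx : x ≠ 0) (hy : y ≠ 0) (hb : b ≠ 0)
    {n m n₁ m₁ n₂ m₂ : ℕ} (h₁ : a * n₁ + b * m₁ = a * n + b * m)
    (h₂ : a * n₂ + b * m₂ = a * n + b * m) (hn₁ : n₁ ≤ n) (hn₂ : n ≤ n₂) :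
    x ^ n * y ^ m ≤ x ^ n₁ * y ^ m₁ + x ^ n₂ * y ^ m₂ := by
  rcases hn₁.eq_or_lt with rfl | hlt
  · obtain rfl : m₁ = m := by exact_mod_cast mul_left_cancel₀ hb (add_left_cancel h₁)
    exact le_self_add
  obtain ⟨i, rfl⟩ := Nat.exists_eq_add_of_le hn₁
  obtain ⟨j, rfl⟩ := Nat.exists_eq_add_of_le hn₂
  have hm : m * (j + i) = m₁ * j + m₂ * i := by
    have : (m : ℝ) * (j + i) = m₁ * j + m₂ * i := mul_left_cancel₀ hb (by
      push_cast at h₁ h₂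
      linear_combination -(j : ℝ) * h₁ - (i : ℝ) * h₂)
    exact_mod_cast this
  refine le_add_of_pow_add_eq (i := j) (j := i)
    (mul_ne_zero (pow_ne_zero n₁ hx) (pow_ne_zero m₁ hy)) (by omega) ?_
  rw [mul_pow, ← pow_mul y, hm]
  ring

end Weight

/-! ### Monomials in reduced correspondences -/

theorem ZMinPlus.eq_zero_or_eq_pow (z : ZMinPlus) :
    z = 0 ∨ ∃ n : ℕ, z = (Tropical.trop 1 : ZMinPlus) ^ n := by
  induction z using Tropical.tropRec with
  | _ z =>
    rcases eq_or_ne z ⊤ with rfl | hz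
    · exact Or.inl rfl
    · obtain ⟨n, rfl⟩ := ENat.ne_top_iff_exists.1 hz
      exact Or.inr ⟨n, by rw [← Tropical.trop_nsmul]; simp⟩

theorem ZMinPlus.trop_one_ne_zero : (Tropical.trop 1 : ZMinPlus) ≠ 0 := fun h =>
  ENat.one_ne_top (congrArg Tropical.untrop h)

theorem ZMinPlus.hom_ext {R : Type u} [CommSemiring R] {f g : ZMinPlus →+* R}
    (h : f (Tropical.trop 1) = g (Tropical.trop 1)) : f = g := by
  ext z
  rcases ZMinPlus.eq_zero_or_eq_pow z with rfl | ⟨n, rfl⟩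
  · rw [map_zero, map_zero]
  · rw [map_pow, map_pow, h]

namespace ReducedCorrespondence

variable (C D : ReducedCorrespondence.{u})

instance : IdemCommSemiring C.carrier := idemCommSemiring C.one_add_one

/-- The left generator `ℓ(q)`. -/
noncomputable def genLeft : C.carrier := C.left (Tropical.trop 1)

/-- The right generator `r(q)`. -/
noncomputable def genRight : C.carrier := C.right (Tropical.trop 1)

/-- The monomial `ℓ(q)^n r(q)^m`. -/
noncomputable def monomial (n m : ℕ) : C.carrier := C.genLeft ^ n * C.genRight ^ m

theorem genLeft_ne_zero : C.genLeft ≠ 0 := fun h =>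
  ZMinPlus.trop_one_ne_zero (C.left_preimage_zero.subset h)

theorem genRight_ne_zero : C.genRight ≠ 0 := fun h =>
  ZMinPlus.trop_one_ne_zero (C.right_preimage_zero.subset h)

theorem closure_genLeft_genRight : Subsemiring.closure {C.genLeft, C.genRight} = ⊤ := by
  have hpow (f : ZMinPlus →+* C.carrier)
      (hf : f (Tropical.trop 1) ∈ Subsemiring.closure {C.genLeft, C.genRight}) (z : ZMinPlus) :
      f z ∈ Subsemiring.closure {C.genLeft, C.genRight} := by
    rcases ZMinPlus.eq_zero_or_eq_pow z with rfl | ⟨n, rfl⟩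
    · rw [map_zero]
      exact zero_mem _
    · rw [map_pow]
      exact pow_mem hf n
  rw [eq_top_iff, ← C.generated, Subsemiring.closure_le]
  rintro _ ⟨x, y, rfl⟩
  exact mul_mem (hpow C.left (Subsemiring.subset_closure (Or.inl rfl)) x)
    (hpow C.right (Subsemiring.subset_closure (Or.inr rfl)) y)

theorem monomial_induction {p : C.carrier → Prop} (zero : p 0)
    (monomial : ∀ n m, p (C.monomial n m)) (add : ∀ a b, p a → p b → p (a + b))
    (a : C.carrier) : p a := by
  have ha : a ∈ Subsemiring.closure {C.genLeft, C.genRight} := by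
    rw [closure_genLeft_genRight]
    exact Subsemiring.mem_top a
  rw [Subsemiring.mem_closure_iff] at ha
  induction ha using AddSubmonoid.closure_induction with
  | zero => exact zero
  | add a b _ _ ha hb => exact add a b ha hb
  | mem a ha =>
    obtain ⟨n, m, rfl⟩ := (Submonoid.mem_closure_pair _ _ _).1 ha
    exact monomial n m

theorem exists_monomial_le {p : C.carrier → Prop} (zero : ¬p 0)
    (add : ∀ a b, p (a + b) → p a ∨ p b) (b : C.carrier) (hb : p b) :
    ∃ n m, C.monomial n m ≤ b ∧ p (C.monomial n m) := by
  induction b using C.monomial_induction with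
  | zero => exact absurd hb zero
  | monomial n m => exact ⟨n, m, le_rfl, hb⟩
  | add a b iha ihb =>
    rcases add a b hb with ha | hb
    · obtain ⟨n, m, hle, hp⟩ := iha ha
      exact ⟨n, m, hle.trans le_self_add, hp⟩
    · obtain ⟨n, m, hle, hp⟩ := ihb hb
      exact ⟨n, m, hle.trans le_add_self, hp⟩

variable {C D}

theorem injective_of_monomial_le {G : Type v} [CommSemiring G] (f : C.carrier →+* G)
    (h : ∀ n m b, f (C.monomial n m) + f b = f b → C.monomial n m ≤ b) :
    Function.Injective f := by
  have hG : (1 : G) + 1 = 1 := by rw [← map_one f, ← map_add, C.one_add_one]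
  let _ := idemCommSemiring hG
  have hle (a b : C.carrier) (hab : f a ≤ f b) : a ≤ b := by
    induction a using C.monomial_induction with
    | zero => exact zero_le
    | monomial n m => exact h n m b (add_eq_right_iff_le.2 hab)
    | add a a' iha iha' =>
      have hab' : f a + f a' ≤ f b := map_add f a a' ▸ hab
      rw [← add_idem b]
      exact add_le_add (iha (le_self_add.trans hab')) (iha' (le_add_self.trans hab'))
  exact fun a b hab => le_antisymm (hle a b hab.le) (hle b a hab.ge)

theorem equal_of_injective {G : Type v} [CommSemiring G] {f : C.carrier →+* G}
    {g : D.carrier →+* G} (hf : Function.Injective f) (hg : Function.Injective g)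
    (hl : f C.genLeft = g D.genLeft) (hr : f C.genRight = g D.genRight) : C.Equal D := by
  have hrange : f.rangeS = g.rangeS := by
    rw [RingHom.rangeS_eq_map, RingHom.rangeS_eq_map, ← C.closure_genLeft_genRight,
      ← D.closure_genLeft_genRight, RingHom.map_closureS, RingHom.map_closureS,
      Set.image_pair, Set.image_pair, hl, hr]
  let eC := RingEquiv.ofLeftInverseS (Function.leftInverse_invFun hf)
  let eD := RingEquiv.ofLeftInverseS (Function.leftInverse_invFun hg)
  let e := (eC.trans (RingEquiv.subsemiringCongr hrange)).trans eD.symm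
  have he (a : C.carrier) : g (e a) = f a := congrArg Subtype.val (eD.apply_symm_apply _)
  exact ⟨e, fun x => hg ((he _).trans (RingHom.congr_fun (ZMinPlus.hom_ext hl :
      f.comp C.left = g.comp D.left) x)),
    fun x => hg ((he _).trans (RingHom.congr_fun (ZMinPlus.hom_ext hr :
      f.comp C.right = g.comp D.right) x))⟩

section Composition

variable (C D)

/-- The morphism `a ↦ a ⊗ 1` to the cancellative reduction of the tensor product. -/
noncomputable def inclLeft : C.carrier →+* CancelReduction (Tensor C D) :=
  (cancelCon (Tensor C D)).mk'.comp
    (Algebra.TensorProduct.includeLeftRingHom.comp C.toViaRight.toRingHom)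

/-- The morphism `b ↦ 1 ⊗ b` to the cancellative reduction of the tensor product. -/
noncomputable def inclRight : D.carrier →+* CancelReduction (Tensor C D) :=
  (cancelCon (Tensor C D)).mk'.comp
    (Algebra.TensorProduct.includeRight.toRingHom.comp D.toViaLeft.toRingHom)

instance : IdemCommSemiring (CancelReduction (Tensor C D)) :=
  idemCommSemiring (by rw [← map_one (inclLeft C D), ← map_add, C.one_add_one])

theorem inclLeft_genRight : inclLeft C D C.genRight = inclRight C D D.genLeft := by
  have h (x : ZMinPlus) : algebraMap ZMinPlus C.ViaRight x ⊗ₜ[ZMinPlus] (1 : D.ViaLeft) =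
      (1 : C.ViaRight) ⊗ₜ[ZMinPlus] algebraMap ZMinPlus D.ViaLeft x := by
    rw [Algebra.algebraMap_eq_smul_one, Algebra.algebraMap_eq_smul_one, TensorProduct.smul_tmul]
  exact congrArg (cancelCon (Tensor C D)).mk' (h _)

variable {C D}

theorem inclLeft_ne_zero {a : C.carrier} (ha : a ≠ 0) : inclLeft C D a ≠ 0 := fun h =>
  (tmul_eq_zero C D (cancelCon_mk_eq_zero.1 h)).elim ha one_ne_zero

theorem inclRight_ne_zero {a : D.carrier} (ha : a ≠ 0) : inclRight C D a ≠ 0 := fun h =>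
  (tmul_eq_zero C D (cancelCon_mk_eq_zero.1 h)).elim one_ne_zero ha

variable (C D) in
/-- The inclusion of the composition in the cancellative reduction of the tensor product. -/
noncomputable def compIncl : (C.comp D).carrier →+* CancelReduction (Tensor C D) :=
  (Subsemiring.closure (Set.range (tensorLeft C D) ∪ Set.range (tensorRight C D))).subtype

theorem compIncl_injective : Function.Injective (compIncl C D) := Subtype.val_injective

theorem isWeakWeight_comp {a b c : ℝ} (hb : 0 < b) (hC : IsWeakWeight C.genLeft C.genRight a b)
    (hD : IsWeakWeight D.genLeft D.genRight b c) :
    IsWeakWeight (C.comp D).genLeft (C.comp D).genRight a c :=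
  .of_map compIncl_injective (.trans (inclLeft_ne_zero C.genLeft_ne_zero)
    (inclLeft_ne_zero C.genRight_ne_zero) (inclRight_ne_zero D.genRight_ne_zero) hb
    (hC.map (inclLeft C D)) (inclLeft_genRight C D ▸ hD.map (inclRight C D)))

theorem isWeight_comp_of_rat {a b c : ℝ} {r : ℚ} (hab : a = r * b)
    (hC : IsWeight C.genLeft C.genRight a b) (hD : IsWeight D.genLeft D.genRight b c) :
    IsWeight (C.comp D).genLeft (C.comp D).genRight a c :=
  .of_map compIncl_injective (.trans_of_rat (inclLeft_ne_zero C.genLeft_ne_zero)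
    (inclLeft_ne_zero C.genRight_ne_zero) (inclRight_ne_zero D.genRight_ne_zero) hab
    (hC.map (inclLeft C D)) (inclLeft_genRight C D ▸ hD.map (inclRight C D)))

theorem exists_tensor_hom {G : Type v} [CommSemiring G] [NoZeroDivisors G] {f : C.carrier →+* G}
    {g : D.carrier →+* G} (hf : ∀ a, f a = 0 → a = 0) (hg : ∀ b, g b = 0 → b = 0)
    (hfg : f C.genRight = g D.genLeft) :
    ∃ F : Tensor C D →+* G, (∀ t, F t = 0 → t = 0) ∧
      ∀ a b, F (C.toViaRight a ⊗ₜ D.toViaLeft b) = f a * g b := by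
  have hG : (1 : G) + 1 = 1 := by rw [← map_one f, ← map_add, C.one_add_one]
  let _ := idemCommSemiring hG
  have hfg' : f.comp C.right = g.comp D.left := ZMinPlus.hom_ext hfg
  let _ : Algebra ZMinPlus G := (f.comp C.right).toAlgebra
  let f' : C.ViaRight →ₐ[ZMinPlus] G :=
    { f.comp C.toViaRight.symm.toRingHom with commutes' := fun _ => rfl }
  let g' : D.ViaLeft →ₐ[ZMinPlus] G :=
    { g.comp D.toViaLeft.symm.toRingHom with
      commutes' := fun x => (RingHom.congr_fun hfg' x).symm }
  let F : Tensor C D →+* G := (Algebra.TensorProduct.productMap f' g').toRingHom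
  have hF (a : C.ViaRight) (b : D.ViaLeft) : F (a ⊗ₜ b) = f' a * g' b := by simp [F]
  refine ⟨F, fun t ht => ?_, fun a b => hF (C.toViaRight a) (D.toViaLeft b)⟩
  induction t using TensorProduct.induction_on with
  | zero => rfl
  | tmul a b =>
    rw [hF] at ht
    rcases mul_eq_zero.1 ht with ha | hb
    · obtain rfl : a = 0 := hf a ha
      exact TensorProduct.zero_tmul _ _
    · obtain rfl : b = 0 := hg b hb
      exact TensorProduct.tmul_zero _ _
  | add s t hs ht' =>
    rw [map_add] at ht
    rw [hs (le_antisymm (le_self_add.trans ht.le) zero_le),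
      ht' (le_antisymm (le_add_self.trans ht.le) zero_le), add_zero]

theorem exists_comp_hom {G : Type v} [CommSemiring G] [IsCancelMulZero G] {f : C.carrier →+* G}
    {g : D.carrier →+* G} (hf : ∀ a, f a = 0 → a = 0) (hg : ∀ b, g b = 0 → b = 0)
    (hfg : f C.genRight = g D.genLeft) :
    ∃ F : (C.comp D).carrier →+* G,
      F (C.comp D).genLeft = f C.genLeft ∧ F (C.comp D).genRight = g D.genRight := by
  obtain ⟨F, hF, hFt⟩ := exists_tensor_hom hf hg hfg
  let F' : CancelReduction (Tensor C D) →+* G := (cancelCon (Tensor C D)).lift F (by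
    rintro a b ⟨c, hc, h⟩
    refine mul_left_cancel₀ (mt (hF c) hc) ?_
    rw [← map_mul, ← map_mul, h])
  refine ⟨F'.comp (compIncl C D), ?_, ?_⟩
  · exact (hFt C.genLeft 1).trans (by rw [map_one, mul_one])
  · exact (hFt 1 D.genRight).trans (by rw [map_one, one_mul])

end Composition

end ReducedCorrespondence

/-! ### Compositions of Frobenius correspondences -/

namespace RMax

noncomputable instance : IdemCommSemiring RMax := idemCommSemiring one_add_one

instance : Nontrivial RMax := ⟨0, 1, fun h => zero_ne_one (congrArg val h)⟩

instance : IsCancelMulZero RMax where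
  mul_left_cancel_of_ne_zero ha _ _ h := mul_left_cancel_of_ne ha h
  mul_right_cancel_of_ne_zero ha _ _ h :=
    mul_left_cancel_of_ne ha (by simpa only [mul_comm] using h)

theorem le_iff_val_le {x y : RMax} : x ≤ y ↔ x.val ≤ y.val := by
  rw [← add_eq_right_iff_le, RMax.ext_iff, val_add, max_eq_right_iff]

theorem le_add_iff {x y z : RMax} : x ≤ y + z ↔ x ≤ y ∨ x ≤ z := by
  simp only [le_iff_val_le, val_add, le_max_iff]

variable {q : ℝ≥0}

theorem qpow_zero : qpow q 0 = 1 := RMax.ext (NNReal.rpow_zero q)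

theorem qpow_add (hq0 : 0 < q) (s t : ℝ) : qpow q (s + t) = qpow q s * qpow q t :=
  RMax.ext (NNReal.rpow_add hq0.ne' s t)

theorem qpow_mul_natCast (hq0 : 0 < q) (s : ℝ) (n : ℕ) : qpow q (s * n) = qpow q s ^ n := by
  induction n with
  | zero => simp [qpow_zero]
  | succ n ih => rw [Nat.cast_succ, mul_add, mul_one, qpow_add hq0, ih, pow_succ]

theorem qpow_le_qpow_iff (hq0 : 0 < q) (hq1 : q < 1) {s t : ℝ} :
    qpow q t ≤ qpow q s ↔ s ≤ t := by
  rw [le_iff_val_le]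
  exact Real.rpow_le_rpow_left_iff_of_base_lt_one (x := q) hq0 hq1

theorem exists_qpow_eq (hq0 : 0 < q) (hq1 : q < 1) {x : RMax} (hx : x ≠ 0) :
    ∃ s, qpow q s = x := by
  have hx' : 0 < x.val := pos_iff_ne_zero.2 fun h => hx (RMax.ext h)
  exact ⟨Real.logb q x.val, RMax.ext (NNReal.eq
    (Real.rpow_logb (by exact_mod_cast hq0) (by exact_mod_cast hq1.ne) (by exact_mod_cast hx')))⟩

theorem eq_zero_of_map_eq_zero {G : Type v} [CommSemiring G] [Nontrivial G] (f : RMax →+* G)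
    {x : RMax} (hx : f x = 0) : x = 0 := by
  by_contra h
  have hmul : x * ⟨x.val⁻¹⟩ = 1 := RMax.ext (mul_inv_cancel₀ fun h' => h (RMax.ext h'))
  exact one_ne_zero (α := G) (by rw [← map_one f, ← hmul, map_mul, hx, zero_mul])

open Classical in
theorem exists_hom (hq0 : 0 < q) (hq1 : q < 1) {G : Type v} [CommSemiring G] {φ : ℝ → G}
    (zero : φ 0 = 1) (add : ∀ s t, φ (s + t) = φ s * φ t)
    (anti : ∀ s t, s ≤ t → φ s + φ t = φ s) :
    ∃ f : RMax →+* G, ∀ s, f (qpow q s) = φ s := by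
  let f (x : RMax) : G := if x = 0 then 0 else φ (Real.logb q x.val)
  have hf0 : f 0 = 0 := if_pos rfl
  have hf (s : ℝ) : f (qpow q s) = φ s := by
    refine (if_neg (qpow_ne_zero hq0 s)).trans (congrArg φ ?_)
    exact Real.logb_rpow (by exact_mod_cast hq0) (by exact_mod_cast hq1.ne)
  have hqpow (x : RMax) : x = 0 ∨ ∃ s, qpow q s = x :=
    or_iff_not_imp_left.2 (exists_qpow_eq hq0 hq1)
  refine ⟨⟨⟨⟨f, ?_⟩, ?_⟩, hf0, ?_⟩, hf⟩
  · rw [← qpow_zero (q := q), hf, zero]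
  · intro x y
    change f (x * y) = f x * f y
    rcases hqpow x with rfl | ⟨s, rfl⟩
    · rw [zero_mul, hf0, zero_mul]
    rcases hqpow y with rfl | ⟨t, rfl⟩
    · rw [mul_zero, hf0, mul_zero]
    · rw [← qpow_add hq0, hf, hf, hf, add]
  · intro x y
    change f (x + y) = f x + f y
    rcases hqpow x with rfl | ⟨s, rfl⟩
    · rw [zero_add, hf0, zero_add]
    rcases hqpow y with rfl | ⟨t, rfl⟩
    · rw [add_zero, hf0, add_zero]
    rcases le_total s t with h | h
    · rw [add_eq_left_iff_le.2 ((qpow_le_qpow_iff hq0 hq1).2 h), hf, hf, anti s t h]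
    · rw [add_eq_right_iff_le.2 ((qpow_le_qpow_iff hq0 hq1).2 h), hf, hf, add_comm, anti t s h]

theorem isWeight_qpow (hq0 : 0 < q) (hq1 : q < 1) (a b : ℝ) :
    IsWeight (qpow q a) (qpow q b) a b := fun n m n' m' h => by
  simpa only [← qpow_mul_natCast hq0, ← qpow_add hq0, qpow_le_qpow_iff hq0 hq1] using h

end RMax

namespace ReducedCorrespondence

variable {C : ReducedCorrespondence.{u}} {q : ℝ≥0}

theorem injective_of_isWeight (hq0 : 0 < q) (hq1 : q < 1) {a b : ℝ}
    (hC : IsWeight C.genLeft C.genRight a b) {f : C.carrier →+* RMax}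
    (hl : f C.genLeft = RMax.qpow q a) (hr : f C.genRight = RMax.qpow q b) :
    Function.Injective f := by
  have hf (n m : ℕ) : f (C.monomial n m) = RMax.qpow q (a * n + b * m) := by
    rw [monomial, map_mul, map_pow, map_pow, hl, hr, RMax.qpow_add hq0, RMax.qpow_mul_natCast hq0,
      RMax.qpow_mul_natCast hq0]
  refine injective_of_monomial_le f fun n m c hc => ?_
  obtain ⟨n', m', hle, hp⟩ := C.exists_monomial_le (p := fun c => f (C.monomial n m) ≤ f c)
    (fun h => RMax.qpow_ne_zero hq0 _ (le_antisymm (hf n m ▸ map_zero f ▸ h) zero_le))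
    (fun c d h => RMax.le_add_iff.1 (map_add f c d ▸ h)) c (add_eq_right_iff_le.1 hc)
  rw [hf, hf, RMax.qpow_le_qpow_iff hq0 hq1] at hp
  exact (hC hp).trans hle

end ReducedCorrespondence

section Frobenius

open ReducedCorrespondence

variable {q : ℝ≥0} (hq0 : 0 < q) (hq1 : q < 1) {lam : ℝ} (hlam : 0 < lam)

/-- The inclusion of the range of `𝓕(λ)` in `ℝ_+^max`. -/
noncomputable def frobeniusIncl : (frobenius q hq0 hq1 lam hlam).carrier →+* RMax :=
  (frobF q hq1 lam hlam).rangeS.subtype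

theorem frobeniusIncl_injective : Function.Injective (frobeniusIncl hq0 hq1 hlam) :=
  Subtype.val_injective

theorem frobeniusIncl_genLeft : frobeniusIncl hq0 hq1 hlam (genLeft _) = RMax.qpow q lam := by
  change frobF q hq1 lam hlam (Tropical.trop 1 ⊗ₜ 1) = _
  simp [frobF, scaleHom, powHom_trop_one]

theorem frobeniusIncl_genRight : frobeniusIncl hq0 hq1 hlam (genRight _) = RMax.qpow q 1 := by
  change frobF q hq1 lam hlam (1 ⊗ₜ Tropical.trop 1) = _
  simp [frobF, scaleHom, powHom_trop_one]

theorem isWeight_frobenius {a b : ℝ} (hb : 0 < b) (hab : a = lam * b) :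
    IsWeight (frobenius q hq0 hq1 lam hlam).genLeft (frobenius q hq0 hq1 lam hlam).genRight
      a b := by
  have h := RMax.isWeight_qpow hq0 hq1 lam 1
  rw [← frobeniusIncl_genLeft hq0 hq1 hlam, ← frobeniusIncl_genRight hq0 hq1 hlam] at h
  simpa only [hab, one_mul] using (h.of_map (frobeniusIncl_injective hq0 hq1 hlam)).mul_right hb

theorem exists_frobenius_embedding {a b : ℝ} (hb : 0 < b) (hab : a = lam * b) :
    ∃ f : (frobenius q hq0 hq1 lam hlam).carrier →+* RMax, Function.Injective f ∧
      f (genLeft _) = RMax.qpow q a ∧ f (genRight _) = RMax.qpow q b := by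
  obtain ⟨scale, hscale⟩ := RMax.exists_hom hq0 hq1 (φ := fun s => RMax.qpow q (b * s))
    (by rw [mul_zero, RMax.qpow_zero]) (fun s t => by rw [mul_add, RMax.qpow_add hq0])
    (fun s t h => add_eq_left_iff_le.2
      ((RMax.qpow_le_qpow_iff hq0 hq1).2 (mul_le_mul_of_nonneg_left h hb.le)))
  let f := scale.comp (frobeniusIncl hq0 hq1 hlam)
  have hl : f (genLeft _) = RMax.qpow q a := by
    rw [RingHom.comp_apply, frobeniusIncl_genLeft, hscale, hab, mul_comm]
  have hr : f (genRight _) = RMax.qpow q b := by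
    rw [RingHom.comp_apply, frobeniusIncl_genRight, hscale, mul_one]
  exact ⟨f, injective_of_isWeight hq0 hq1 (isWeight_frobenius hq0 hq1 hlam hb hab) hl hr, hl, hr⟩

variable {lam' : ℝ} (hlam' : 0 < lam')

theorem frobenius_comp_equal_of_isWeight
    (h : IsWeight ((frobenius q hq0 hq1 lam hlam).comp (frobenius q hq0 hq1 lam' hlam')).genLeft
      ((frobenius q hq0 hq1 lam hlam).comp (frobenius q hq0 hq1 lam' hlam')).genRight
      (lam * lam') 1) :
    ((frobenius q hq0 hq1 lam hlam).comp (frobenius q hq0 hq1 lam' hlam')).Equal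
      (frobenius q hq0 hq1 (lam * lam') (mul_pos hlam hlam')) := by
  obtain ⟨f, hf, hfl, hfr⟩ := exists_frobenius_embedding hq0 hq1 hlam hlam' rfl
  obtain ⟨g, hg, hgl, hgr⟩ :=
    exists_frobenius_embedding hq0 hq1 hlam' one_pos (mul_one lam').symm
  obtain ⟨k, hk, hkl, hkr⟩ :=
    exists_frobenius_embedding hq0 hq1 (mul_pos hlam hlam') one_pos (mul_one (lam * lam')).symm
  obtain ⟨F, hFl, hFr⟩ := exists_comp_hom (fun a => (map_eq_zero_iff f hf).1)
    (fun a => (map_eq_zero_iff g hg).1) (hfr.trans hgl.symm)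
  rw [hfl] at hFl
  rw [hgr] at hFr
  exact equal_of_injective (injective_of_isWeight hq0 hq1 h hFl hFr) hk (hFl.trans hkl.symm)
    (hFr.trans hkr.symm)

theorem frobenius_comp_equal_of_irrational (h : Irrational (lam * lam')) :
    ((frobenius q hq0 hq1 lam hlam).comp (frobenius q hq0 hq1 lam' hlam')).Equal
      (frobenius q hq0 hq1 (lam * lam') (mul_pos hlam hlam')) := by
  refine frobenius_comp_equal_of_isWeight hq0 hq1 hlam hlam' ?_
  exact (isWeakWeight_comp hlam' (isWeight_frobenius hq0 hq1 hlam hlam' rfl).isWeakWeight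
    (isWeight_frobenius hq0 hq1 hlam' one_pos (mul_one lam').symm).isWeakWeight
    ).isWeight_of_irrational (by rwa [div_one])

theorem frobenius_comp_equal_of_rat (h : lam ∈ Set.range ((↑) : ℚ → ℝ)) :
    ((frobenius q hq0 hq1 lam hlam).comp (frobenius q hq0 hq1 lam' hlam')).Equal
      (frobenius q hq0 hq1 (lam * lam') (mul_pos hlam hlam')) := by
  obtain ⟨r, rfl⟩ := h
  exact frobenius_comp_equal_of_isWeight hq0 hq1 hlam hlam' (isWeight_comp_of_rat rfl
    (isWeight_frobenius hq0 hq1 hlam hlam' rfl)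
    (isWeight_frobenius hq0 hq1 hlam' one_pos (mul_one lam').symm))

end Frobenius

/-! ### Deformation by germs -/

theorem exists_addMonoidHom_of_irrational_div {a b : ℝ} (h : Irrational (a / b)) :
    ∃ D : ℝ →+ ℝ, D a = a ∧ D b = 0 := by
  have ha : a ∉ Submodule.span ℚ {b} := fun hab => by
    obtain ⟨r, rfl⟩ := Submodule.mem_span_singleton.1 hab
    rcases eq_or_ne b 0 with rfl | hb
    · exact h ⟨0, by simp⟩
    · exact h ⟨r, by rw [Rat.smul_def, mul_div_cancel_right₀ _ hb]⟩
  obtain ⟨D, hD, hDa⟩ :=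
    LinearMap.exists_extend_of_notMem (0 : Submodule.span ℚ {b} →ₗ[ℚ] ℝ) ha a
  exact ⟨D.toAddMonoidHom, hDa,
    LinearMap.congr_fun hD ⟨b, Submodule.mem_span_singleton_self b⟩⟩

section Germ

variable {q : ℝ≥0} (hq0 : 0 < q)

/-- The germs which are zero or vanish nowhere near `0`: a multiplicatively cancellative
semiring containing all the germs `q^(s(ε))`. -/
def nonvanishingGerms : Subsemiring contGerm where
  carrier := {x | x = 0 ∨ NonvanishingGerm x}
  zero_mem' := Or.inl rfl
  one_mem' := Or.inr .one
  add_mem' := by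
    rintro x y (rfl | hx) (rfl | hy)
    · exact Or.inl (add_zero 0)
    · exact Or.inr (by rwa [zero_add])
    · exact Or.inr (by rwa [add_zero])
    · exact Or.inr (hx.add hy)
  mul_mem' := by
    rintro x y (rfl | hx) (rfl | hy)
    · exact Or.inl (zero_mul 0)
    · exact Or.inl (zero_mul y)
    · exact Or.inl (mul_zero x)
    · exact Or.inr (hx.mul hy)

theorem nonvanishingGerms_one_add_one : (1 : nonvanishingGerms) + 1 = 1 :=
  Subtype.ext contGerm_one_add_one

instance : Nontrivial nonvanishingGerms :=
  ⟨0, 1, fun h => NonvanishingGerm.one.ne_zero (congrArg Subtype.val h).symm⟩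

instance : IsCancelMulZero nonvanishingGerms := by
  have key {x y z : nonvanishingGerms} (hx : x ≠ 0) (h : x * y = x * z) : y = z :=
    Subtype.ext ((x.2.resolve_left fun h0 => hx (Subtype.ext h0)).mul_left_cancel
      (congrArg Subtype.val h))
  exact { mul_left_cancel_of_ne_zero := fun hx _ _ h => key hx h
          mul_right_cancel_of_ne_zero := fun hx _ _ h =>
            key hx (by simpa only [mul_comm] using h) }

/-- The germ of `ε ↦ q^(s + ε t)`. -/
noncomputable def linearGerm (s t : ℝ) : nonvanishingGerms :=
  ⟨qgerm q hq0 (fun e => s + e * t) (by fun_prop), Or.inr (qgerm_nonvanishing q hq0 _ _)⟩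

theorem linearGerm_zero : linearGerm hq0 0 0 = 1 := by
  refine Subtype.ext (Subtype.ext (Filter.Germ.coe_eq.2 (.of_forall fun e => ?_)))
  change RMax.qpow q (0 + e * 0) = 1
  rw [mul_zero, add_zero, RMax.qpow_zero]

theorem linearGerm_add (s t s' t' : ℝ) :
    linearGerm hq0 (s + s') (t + t') = linearGerm hq0 s t * linearGerm hq0 s' t' := by
  refine Subtype.ext (Subtype.ext (Filter.Germ.coe_eq.2 (.of_forall fun e => ?_)))
  change RMax.qpow q (s + s' + e * (t + t')) = RMax.qpow q (s + e * t) * RMax.qpow q (s' + e * t')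
  rw [← RMax.qpow_add hq0]
  congr 1
  ring

theorem linearGerm_mul_natCast (s t : ℝ) (n : ℕ) :
    linearGerm hq0 (s * n) (t * n) = linearGerm hq0 s t ^ n := by
  induction n with
  | zero => rw [Nat.cast_zero, mul_zero, mul_zero, linearGerm_zero, pow_zero]
  | succ n ih => simp only [Nat.cast_succ, mul_add, mul_one, linearGerm_add, ih, pow_succ]

theorem linearGerm_add_eq_left (hq1 : q < 1) {s s' : ℝ} (h : s < s') (t t' : ℝ) :
    linearGerm hq0 s t + linearGerm hq0 s' t' = linearGerm hq0 s t := by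
  have hlt : ∀ᶠ e : ℝ in 𝓝 0, s + e * t < s' + e * t' :=
    ContinuousAt.eventually_lt (by fun_prop) (by fun_prop) (by simpa using h)
  exact Subtype.ext (Subtype.ext (Filter.Germ.coe_eq.2 (hlt.mono fun _ he =>
    add_eq_left_iff_le.2 ((RMax.qpow_le_qpow_iff hq0 hq1).2 he.le))))

theorem exists_deformation (hq1 : q < 1) (D : ℝ →+ ℝ) :
    ∃ f : RMax →+* nonvanishingGerms, ∀ s, f (RMax.qpow q s) = linearGerm hq0 s (D s) := by
  refine RMax.exists_hom hq0 hq1 (φ := fun s => linearGerm hq0 s (D s)) ?_ ?_ ?_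
  · rw [map_zero, linearGerm_zero]
  · intro s t
    rw [map_add, linearGerm_add]
  · intro s t hst
    rcases hst.eq_or_lt with rfl | hlt
    · rw [← two_mul, ← one_add_one_eq_two, nonvanishingGerms_one_add_one, one_mul]
    · exact linearGerm_add_eq_left hq0 hq1 hlt _ _

end Germ

namespace ReducedCorrespondence

variable {C : ReducedCorrespondence.{u}} {q : ℝ≥0} {c : ℝ} {F : C.carrier →+* nonvanishingGerms}

theorem map_monomial_of_linearGerm (hq0 : 0 < q) (hl : F C.genLeft = linearGerm hq0 1 1)
    (hr : F C.genRight = linearGerm hq0 c 0) (n m : ℕ) :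
    F (C.monomial n m) = linearGerm hq0 (1 * n + c * m) n := by
  rw [monomial, map_mul, map_pow, map_pow, hl, hr, ← linearGerm_mul_natCast,
    ← linearGerm_mul_natCast, ← linearGerm_add, one_mul, zero_mul, add_zero]

theorem exists_monomial_le_of_linearGerm_add_eq (hq0 : 0 < q) (hq1 : q < 1)
    (hl : F C.genLeft = linearGerm hq0 1 1) (hr : F C.genRight = linearGerm hq0 c 0)
    {l : Filter ℝ} [l.NeBot] (hl0 : l ≤ 𝓝 0) {s t : ℝ} {b : C.carrier}
    (hb : linearGerm hq0 s t + F b = F b) :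
    ∃ n m : ℕ, C.monomial n m ≤ b ∧ ∃ᶠ e in l, 1 * n + c * m + e * n ≤ s + e * t := by
  let p (b : C.carrier) : Prop := ∃ g : ℝ → RMax,
    (F b).1.1 = g ∧ ∃ᶠ e in l, RMax.qpow q (s + e * t) ≤ g e
  have hpb : p b := by
    obtain ⟨g, -, hg⟩ := (F b).1.2
    have h : (linearGerm hq0 s t).1.1 + (F b).1.1 = (F b).1.1 :=
      congrArg (fun x : nonvanishingGerms => x.1.1) hb
    rw [hg] at h
    have hle := (Filter.Germ.coe_eq.1 h).mono fun _ => add_eq_right_iff_le.1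
    exact ⟨g, hg, (hle.filter_mono hl0).frequently⟩
  have zero : ¬p 0 := by
    rintro ⟨g, hg, h⟩
    rw [map_zero] at hg
    obtain ⟨e, he, h0⟩ := (h.and_eventually (hl0 (Filter.Germ.coe_eq.1 hg))).exists
    exact RMax.qpow_ne_zero hq0 _ (le_antisymm (he.trans_eq h0.symm) zero_le)
  have add (b b' : C.carrier) : p (b + b') → p b ∨ p b' := by
    rintro ⟨g, hg, h⟩
    obtain ⟨k, -, hk⟩ := (F b).1.2
    obtain ⟨k', -, hk'⟩ := (F b').1.2
    rw [map_add, Subsemiring.coe_add, Subsemiring.coe_add, hk, hk'] at hg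
    have h' := (h.and_eventually (hl0 (Filter.Germ.coe_eq.1 hg))).mono fun e he =>
      RMax.le_add_iff.1 (he.1.trans_eq he.2.symm)
    exact (Filter.frequently_or_distrib.1 h').imp (⟨k, hk, ·⟩) (⟨k', hk', ·⟩)
  obtain ⟨n, m, hle, g, hg, h⟩ := C.exists_monomial_le zero add b hpb
  rw [map_monomial_of_linearGerm hq0 hl hr] at hg
  refine ⟨n, m, hle, (h.and_eventually (hl0 (Filter.Germ.coe_eq.1 hg))).mono fun e he => ?_⟩
  exact (RMax.qpow_le_qpow_iff hq0 hq1).1 (he.1.trans_eq he.2.symm)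

theorem monomial_le_or_exists_frequently_le (hq0 : 0 < q) (hq1 : q < 1)
    (hC : IsWeakWeight C.genLeft C.genRight 1 c) (hl : F C.genLeft = linearGerm hq0 1 1)
    (hr : F C.genRight = linearGerm hq0 c 0) {l : Filter ℝ} [l.NeBot] (hl0 : l ≤ 𝓝 0) {n m : ℕ}
    {b : C.carrier} (hb : F (C.monomial n m) + F b = F b) :
    C.monomial n m ≤ b ∨ ∃ n' m' : ℕ, C.monomial n' m' ≤ b ∧
      1 * (n' : ℝ) + c * m' = 1 * n + c * m ∧ ∃ᶠ e in l, e * (n' : ℝ) ≤ e * n := by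
  rw [map_monomial_of_linearGerm hq0 hl hr] at hb
  obtain ⟨n', m', hle, h⟩ := exists_monomial_le_of_linearGerm_add_eq hq0 hq1 hl hr hl0 hb
  have ht (s t : ℝ) : Filter.Tendsto (fun e : ℝ => s + e * t) l (𝓝 s) :=
    ((by fun_prop : Continuous fun e : ℝ => s + e * t).tendsto' 0 s (by simp)).mono_left hl0
  rcases (le_of_tendsto_of_tendsto_of_frequently (ht _ _) (ht _ _) h).lt_or_eq with hlt | heq
  · exact Or.inl ((hC hlt).trans hle)
  · exact Or.inr ⟨n', m', hle, heq, h.mono fun e he => by rwa [heq, add_le_add_iff_left] at he⟩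

theorem injective_of_isWeakWeight (hq0 : 0 < q) (hq1 : q < 1) (hc : c ≠ 0)
    (hC : IsWeakWeight C.genLeft C.genRight 1 c) (hl : F C.genLeft = linearGerm hq0 1 1)
    (hr : F C.genRight = linearGerm hq0 c 0) : Function.Injective F := by
  refine injective_of_monomial_le F fun n m b hb => ?_
  rcases monomial_le_or_exists_frequently_le hq0 hq1 hC hl hr (l := 𝓝[>] 0) nhdsWithin_le_nhds hb
    with h | ⟨n₁, m₁, hle₁, heq₁, h₁⟩
  · exact h
  rcases monomial_le_or_exists_frequently_le hq0 hq1 hC hl hr (l := 𝓝[<] 0) nhdsWithin_le_nhds hb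
    with h | ⟨n₂, m₂, hle₂, heq₂, h₂⟩
  · exact h
  obtain ⟨e₁, h₁, he₁⟩ := (h₁.and_eventually self_mem_nhdsWithin).exists
  obtain ⟨e₂, h₂, he₂⟩ := (h₂.and_eventually self_mem_nhdsWithin).exists
  have hn₁ : n₁ ≤ n := by exact_mod_cast (mul_le_mul_iff_right₀ he₁).1 h₁
  have hn₂ : n ≤ n₂ := by exact_mod_cast (mul_le_mul_left_of_neg he₂).1 h₂
  calc C.monomial n m ≤ C.monomial n₁ m₁ + C.monomial n₂ m₂ :=
        pow_mul_pow_le_add_of_between C.genLeft_ne_zero C.genRight_ne_zero hc heq₁ heq₂ hn₁ hn₂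
    _ ≤ b + b := add_le_add hle₁ hle₂
    _ = b := add_idem b

end ReducedCorrespondence

section Deformation

open ReducedCorrespondence

variable {q : ℝ≥0} (hq0 : 0 < q) (hq1 : q < 1)

/-- The inclusion of `𝓡_ε` in the semiring of nonvanishing germs. -/
noncomputable def idDeformIncl : (idDeform q hq0 hq1).carrier →+* nonvanishingGerms :=
  Subsemiring.inclusion (T := nonvanishingGerms) (deformedSemiring_nonvanishing q hq0)

theorem idDeformIncl_injective : Function.Injective (idDeformIncl hq0 hq1) :=
  Set.inclusion_injective (deformedSemiring_nonvanishing q hq0)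

theorem idDeformIncl_genLeft : idDeformIncl hq0 hq1 (genLeft _) = linearGerm hq0 1 1 := by
  refine Subtype.ext ((powHom_trop_one contGerm_one_add_one (qDeform q hq0)
    (qDeform_add_one q hq0 hq1)).trans ?_)
  simp only [linearGerm, qDeform, mul_one]

theorem idDeformIncl_genRight : idDeformIncl hq0 hq1 (genRight _) = linearGerm hq0 1 0 := by
  refine Subtype.ext ((powHom_trop_one contGerm_one_add_one (qConst q hq0)
    (qConst_add_one q hq0 hq1)).trans ?_)
  simp only [linearGerm, qConst, mul_zero, add_zero]

theorem isWeakWeight_idDeform :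
    IsWeakWeight (idDeform q hq0 hq1).genLeft (idDeform q hq0 hq1).genRight 1 1 := by
  intro n m n' m' hlt
  change monomial _ _ _ ≤ monomial _ _ _
  rw [← add_eq_left_iff_le]
  refine idDeformIncl_injective hq0 hq1 ?_
  have h := map_monomial_of_linearGerm hq0 (idDeformIncl_genLeft hq0 hq1)
    (idDeformIncl_genRight hq0 hq1)
  rw [map_add, h, h, linearGerm_add_eq_left hq0 hq1 hlt]

variable {lam : ℝ} (hlam : 0 < lam) {lam' : ℝ} (hlam' : 0 < lam')

theorem exists_frobenius_comp_embedding (h : Irrational lam) {c : ℝ} (hc : 0 < c)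
    (hlc : lam⁻¹ = lam' * c) :
    ∃ F : ((frobenius q hq0 hq1 lam hlam).comp (frobenius q hq0 hq1 lam' hlam')).carrier →+*
        nonvanishingGerms, Function.Injective F ∧ F (genLeft _) = linearGerm hq0 1 1 ∧
      F (genRight _) = linearGerm hq0 c 0 := by
  have hl : 1 = lam * lam⁻¹ := (mul_inv_cancel₀ hlam.ne').symm
  have hlam0 : 0 < lam⁻¹ := inv_pos.2 hlam
  obtain ⟨D, hD₁, hD⟩ :=
    exists_addMonoidHom_of_irrational_div (a := 1) (b := lam⁻¹) (by rwa [one_div, inv_inv])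
  obtain ⟨δ, hδ⟩ := exists_deformation hq0 hq1 D
  obtain ⟨κ, hκ⟩ := exists_deformation hq0 hq1 0
  obtain ⟨f, hf, hfl, hfr⟩ := exists_frobenius_embedding hq0 hq1 hlam hlam0 hl
  obtain ⟨g, hg, hgl, hgr⟩ := exists_frobenius_embedding hq0 hq1 hlam' hc hlc
  obtain ⟨F, hFl, hFr⟩ := exists_comp_hom (f := δ.comp f) (g := κ.comp g)
    (fun a ha => (map_eq_zero_iff f hf).1 (RMax.eq_zero_of_map_eq_zero δ ha))
    (fun a ha => (map_eq_zero_iff g hg).1 (RMax.eq_zero_of_map_eq_zero κ ha))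
    (by simp [hfr, hgl, hδ, hκ, hD])
  replace hFl : F (genLeft _) = linearGerm hq0 1 1 := by simp [hFl, hfl, hδ, hD₁]
  replace hFr : F (genRight _) = linearGerm hq0 c 0 := by simp [hFr, hgr, hκ]
  exact ⟨F, injective_of_isWeakWeight hq0 hq1 hc.ne'
    (isWeakWeight_comp hlam0 (isWeight_frobenius hq0 hq1 hlam hlam0 hl).isWeakWeight
      (isWeight_frobenius hq0 hq1 hlam' hc hlc).isWeakWeight) hFl hFr, hFl, hFr⟩

theorem exists_idDeform_comp_embedding {c : ℝ} (hc : 0 < c) (hlc : 1 = lam * c) :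
    ∃ F : ((idDeform q hq0 hq1).comp (frobenius q hq0 hq1 lam hlam)).carrier →+*
        nonvanishingGerms, Function.Injective F ∧ F (genLeft _) = linearGerm hq0 1 1 ∧
      F (genRight _) = linearGerm hq0 c 0 := by
  obtain ⟨κ, hκ⟩ := exists_deformation hq0 hq1 0
  obtain ⟨g, hg, hgl, hgr⟩ := exists_frobenius_embedding hq0 hq1 hlam hc hlc
  obtain ⟨F, hFl, hFr⟩ := exists_comp_hom (f := idDeformIncl hq0 hq1) (g := κ.comp g)
    (fun a => (map_eq_zero_iff _ (idDeformIncl_injective hq0 hq1)).1)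
    (fun a ha => (map_eq_zero_iff g hg).1 (RMax.eq_zero_of_map_eq_zero κ ha))
    (by simp [idDeformIncl_genRight, hgl, hκ])
  rw [idDeformIncl_genLeft] at hFl
  replace hFr : F (genRight _) = linearGerm hq0 c 0 := by simp [hFr, hgr, hκ]
  exact ⟨F, injective_of_isWeakWeight hq0 hq1 hc.ne'
    (isWeakWeight_comp one_pos (isWeakWeight_idDeform hq0 hq1)
      (isWeight_frobenius hq0 hq1 hlam hc hlc).isWeakWeight) hFl hFr, hFl, hFr⟩

theorem frobenius_comp_equal_idDeform_comp (h : Irrational lam) :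
    ((frobenius q hq0 hq1 lam hlam).comp (frobenius q hq0 hq1 lam' hlam')).Equal
      ((idDeform q hq0 hq1).comp
        (frobenius q hq0 hq1 (lam * lam') (mul_pos hlam hlam'))) := by
  have hc : 0 < (lam * lam')⁻¹ := inv_pos.2 (mul_pos hlam hlam')
  obtain ⟨F, hF, hFl, hFr⟩ := exists_frobenius_comp_embedding hq0 hq1 hlam hlam' h hc
    (by rw [mul_inv_rev, mul_inv_cancel_left₀ hlam'.ne'])
  obtain ⟨G, hG, hGl, hGr⟩ := exists_idDeform_comp_embedding hq0 hq1 (mul_pos hlam hlam') hc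
    (mul_inv_cancel₀ (mul_pos hlam hlam').ne').symm
  exact equal_of_injective hF hG (hFl.trans hGl.symm) (hFr.trans hGr.symm)

end Deformation

end ArithmeticSite

theorem theorem6p5_general (q : ℝ≥0) (hq0 : 0 < q) (hq1 : q < 1)
    (lam lam' : ℝ) (hlam : 0 < lam) (hlam' : 0 < lam') :
    (lam ∈ Set.range ((↑) : ℚ → ℝ) ∨ Irrational (lam * lam') →
      ((ArithmeticSite.frobenius q hq0 hq1 lam hlam).comp
        (ArithmeticSite.frobenius q hq0 hq1 lam' hlam')).Equal
          (ArithmeticSite.frobenius q hq0 hq1 (lam * lam') (mul_pos hlam hlam'))) ∧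
    (Irrational lam →
      ((ArithmeticSite.frobenius q hq0 hq1 lam hlam).comp
        (ArithmeticSite.frobenius q hq0 hq1 lam' hlam')).Equal
          ((ArithmeticSite.idDeform q hq0 hq1).comp
            (ArithmeticSite.frobenius q hq0 hq1 (lam * lam') (mul_pos hlam hlam')))) :=
  ⟨fun h => h.elim (ArithmeticSite.frobenius_comp_equal_of_rat hq0 hq1 hlam hlam')
    (ArithmeticSite.frobenius_comp_equal_of_irrational hq0 hq1 hlam hlam'),
    ArithmeticSite.frobenius_comp_equal_idDeform_comp hq0 hq1 hlam hlam'⟩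

theorem theorem6p5 (q : ℝ≥0) (hq0 : 0 < q) (hq1 : q < 1)
    (lam lam' : ℝ) (hlam : 0 < lam) (hlam' : 0 < lam') :
    (Irrational (lam * lam') →
      ((ArithmeticSite.frobenius q hq0 hq1 lam hlam).comp
        (ArithmeticSite.frobenius q hq0 hq1 lam' hlam')).Equal
          (ArithmeticSite.frobenius q hq0 hq1 (lam * lam') (mul_pos hlam hlam'))) ∧
    (lam ∈ Set.range ((↑) : ℚ → ℝ) → lam' ∈ Set.range ((↑) : ℚ → ℝ) →
      ((ArithmeticSite.frobenius q hq0 hq1 lam hlam).comp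
        (ArithmeticSite.frobenius q hq0 hq1 lam' hlam')).Equal
          (ArithmeticSite.frobenius q hq0 hq1 (lam * lam') (mul_pos hlam hlam'))) ∧
    (Irrational lam → Irrational lam' → lam * lam' ∈ Set.range ((↑) : ℚ → ℝ) →
      ((ArithmeticSite.frobenius q hq0 hq1 lam hlam).comp
        (ArithmeticSite.frobenius q hq0 hq1 lam' hlam')).Equal
          ((ArithmeticSite.idDeform q hq0 hq1).comp
            (ArithmeticSite.frobenius q hq0 hq1 (lam * lam') (mul_pos hlam hlam')))) := by
  obtain ⟨hΨ, hε⟩ := theorem6p5_general q hq0 hq1 lam lam' hlam hlam'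
  exact ⟨fun h => hΨ (.inr h), fun h _ => hΨ (.inl h), fun h _ _ => hε h⟩
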